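/- Let $K$ be an algebraically closed field (of any characteristic), let $N\ge 0$, $1\le c\le N+1$ and $d_1,\dots,d_c\ge 1$ be integers. Let $V=\bigoplus_{i=1}^c H^0(\mathbb P^N_K,\mathcal O(d_i))$ be the space of $c$-tuples $(F_1,\dots,F_c)$ of homogeneous polynomials of degrees $d_1,\dots,d_c$ in $X_0,\dots,X_N$, with its Zariski topology, and let $D\subset V$ be the discriminant locus, i.e. the set of those $(F_1,\dots,F_c)$ for which the scheme $\{F_1=\dots=F_c=0\}\subset\mathbb P^N$ is not smooth of codimension $c$ (where "smooth of codimension $r$" means smooth over $K$ of pure dimension $N-r$, and empty if $r=N+1$). Then $D$ is closed in $V$ and irreducible. Moreover, if $(F_1,\dots,F_c)$ is a general point of $D$ (that is, for all points of some dense Zariski-open subset of $D$), then: (i) there is a point of $\{F_1=\dots=F_c=0\}$, with all homogeneous coordinates nonzero, at which this scheme is singular, in the sense that it is not smooth of codimension $c$ in $\mathbb P^N$ at that point; (ii) for every proper subset $I\subsetneq\{1,\dots,c\}$, the scheme $\{F_i=0,\ i\in I\}\subset\mathbb P^N$ is smooth of codimension $|I|$. -/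

import Mathlib

open MvPolynomial
open scoped Topology

noncomputable section

/-- The zero set in a `K`-vector space `V` of a set of polynomial functions on `V`, a polynomial
function being a polynomial expression in linear forms on `V`. -/
def polyZeros (K V : Type*) [Field K] [AddCommGroup V] [Module K V]
    (T : Set (MvPolynomial (Module.Dual K V) K)) : Set V :=
  {v | ∀ f ∈ T, eval (fun φ : Module.Dual K V => φ v) f = 0}

/-- The Zariski topology on (the `K`-points of) a `K`-vector space `V`: the closed sets are the
zero sets of polynomial functions. -/
@[reducible]
def zariskiTopology (K V : Type*) [Field K] [AddCommGroup V] [Module K V] :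
    TopologicalSpace V :=
  TopologicalSpace.ofClosed {Z | ∃ T, Z = polyZeros K V T}
    ⟨{1}, by ext v; simp [polyZeros]⟩
    (by
      intro A hA
      choose T hT using fun Z : A => hA Z.2
      refine ⟨⋃ Z, T Z, ?_⟩
      ext v
      simp only [polyZeros, Set.mem_sInter, Set.mem_iUnion, Set.mem_ofPred_eq]
      constructor
      · rintro h f ⟨Z, hf⟩
        have := h Z Z.2
        rw [hT Z] at this
        exact this f hf
      · intro h Z hZ
        change v ∈ ((⟨Z, hZ⟩ : A) : Set V)
        rw [hT ⟨Z, hZ⟩]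
        exact fun f hf => h f ⟨⟨Z, hZ⟩, hf⟩)
    (by
      rintro _ ⟨S, rfl⟩ _ ⟨T, rfl⟩
      refine ⟨{h | ∃ f ∈ S, ∃ g ∈ T, h = f * g}, ?_⟩
      ext v
      simp only [polyZeros, Set.mem_union, Set.mem_ofPred_eq]
      constructor
      · rintro (h | h) _ ⟨f, hf, g, hg, rfl⟩
        · simp [h f hf]
        · simp [h g hg]
      · intro h
        by_contra! hc
        obtain ⟨⟨f, hf, hf0⟩, ⟨g, hg, hg0⟩⟩ := hc
        have := h _ ⟨f, hf, g, hg, rfl⟩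
        rw [map_mul] at this
        exact (mul_ne_zero hf0 hg0) this)

theorem isClosed_zariskiTopology_iff {K V : Type*} [Field K] [AddCommGroup V] [Module K V]
    {Z : Set V} : IsClosed[zariskiTopology K V] Z ↔ ∃ T, Z = polyZeros K V T := by
  rw [← @isOpen_compl_iff _ _ (zariskiTopology K V)]
  change Zᶜᶜ ∈ {Z | ∃ T, Z = polyZeros K V T} ↔ _
  rw [compl_compl]
  rfl

/-- The space `V = ⨁ᵢ H⁰(ℙ^N, 𝒪(dᵢ))` of `c`-tuples of homogeneous polynomials of degrees
`d₁, …, d_c` in `N + 1` variables. -/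
abbrev EqSpace (K : Type*) [Field K] (N : ℕ) {c : ℕ} (d : Fin c → ℕ) : Type _ :=
  (i : Fin c) → homogeneousSubmodule (Fin (N + 1)) K (d i)

section Chart

variable {K : Type*} [Field K] {N : ℕ} {ι : Type*}

/-- The coordinate ring of the standard affine chart `{X_j ≠ 0}` (that is, `X_j = 1`) of the
closed subscheme `{F_i = 0, i ∈ ι}` of `ℙ^N`, for homogeneous polynomials `F_i`. -/
abbrev ChartRing (F : ι → MvPolynomial (Fin (N + 1)) K) (j : Fin (N + 1)) : Type _ :=
  MvPolynomial (Fin (N + 1)) K ⧸ Ideal.span (insert (X j - 1) (Set.range F))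

/-- The scheme `{F_i = 0, i ∈ ι} ⊆ ℙ^N` is smooth over `K`, of codimension `r` in `ℙ^N`, at the
point given by the prime `p` of its `j`-th standard chart: its local ring there is formally smooth
over `K` and the stalk of the module of differentials (which is then free) has rank `N - r`. -/
def IsSmoothOfCodimAt (F : ι → MvPolynomial (Fin (N + 1)) K) (r : ℕ) (j : Fin (N + 1))
    (p : PrimeSpectrum (ChartRing F j)) : Prop :=
  Algebra.IsSmoothAt K p.asIdeal ∧
    Module.rankAtStalk (R := ChartRing F j) Ω[ChartRing F j⁄K] p + r = N

/-- The scheme `{F_i = 0, i ∈ ι} ⊆ ℙ^N` is smooth over `K` of codimension `r` in `ℙ^N`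
(for `r > N` this means that it is empty). -/
def IsSmoothOfCodim (F : ι → MvPolynomial (Fin (N + 1)) K) (r : ℕ) : Prop :=
  ∀ (j : Fin (N + 1)) (p : PrimeSpectrum (ChartRing F j)), IsSmoothOfCodimAt F r j p

/-- The `K`-point of `ℙ^N` with homogeneous coordinates `x` lies on the scheme
`{F_i = 0, i ∈ ι}`, and this scheme is not smooth of codimension `r` there. -/
def IsSingularPoint (F : ι → MvPolynomial (Fin (N + 1)) K) (r : ℕ) (x : Fin (N + 1) → K) : Prop :=
  ∃ (j : Fin (N + 1)) (p : PrimeSpectrum (ChartRing F j)), x j ≠ 0 ∧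
    (∀ G : MvPolynomial (Fin (N + 1)) K,
      Ideal.Quotient.mk _ G ∈ p.asIdeal ↔ eval ((x j)⁻¹ • x) G = 0) ∧
    ¬ IsSmoothOfCodimAt F r j p

end Chart

/-- The discriminant locus: the set of the `(F₁, …, F_c)` such that `{F₁ = ⋯ = F_c = 0}` is not
smooth of codimension `c` in `ℙ^N`. -/
def discriminantLocus (K : Type*) [Field K] (N : ℕ) {c : ℕ} (d : Fin c → ℕ) :
    Set (EqSpace K N d) :=
  {F | ¬ IsSmoothOfCodim (fun i => (F i : MvPolynomial (Fin (N + 1)) K)) c}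

end

/-! ### Differentials at a smooth point. -/

noncomputable section

/-! By the Jacobian criterion (`isSmoothOfCodim_iff`), F lies in the discriminant D iff there are x
≠ 0 and μ ≠ 0 with F_i(x) = 0 for all i and ∑ μ_i dF_i(x) = 0. For fixed (x, μ) these equations are
linear in the coefficients of F. In the chart x_j = 1, μ_k = 1 they can be solved, in every
characteristic, for the coefficients of X_j^{d_i} in F_i and of X_j^{d_k-1} X_l (l ≠ j) in F_k; the
equation for ∂_j follows from Euler's relation. So each chart of the incidence variety is an affine
space, mapped to V by `genericCoeff`. Any two charts share a dense open subset, so a polynomial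
vanishing on the image of one chart vanishes on all of D (`HasSing.eval_eq_zero`); hence D is
irreducible. Closedness is elimination theory (`exists_forall_no_common_zero`).

By irreducibility, the generic assertions only need nonempty open subsets of D. For (i), Chevalley's
theorem (`exists_forall_exists_eval_eq`) is applied to the parameters for which all coordinates of x
are nonzero. For (ii), smoothness of a subfamily is an open condition, so one tuple in D satisfying
it suffices. A chart has fewer parameters than V has coordinates, so nonsingular tuples exist
(`exists_not_hasSing`). Take one indexed by I and complete it by zero forms: since |I| ≤ N, the
forms have a common zero (`exists_ne_zero_forall_eval_eq_zero`), where a zero form supplies the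
relation, so the completed tuple lies in D. -/

open scoped TensorProduct in
/-- At a smooth prime, the rank of the module of differentials is the dimension of the space of
derivations into the residue field. -/
theorem rankAtStalk_kaehlerDifferential_eq_finrank {K B : Type*} [Field K] [CommRing B]
    [Algebra K B] [Algebra.EssFiniteType K B] (p : PrimeSpectrum B)
    (hp : Algebra.IsSmoothAt K p.asIdeal) :
    Module.rankAtStalk (R := B) Ω[B⁄K] p =
      Module.finrank p.asIdeal.ResidueField (Ω[B⁄K] →ₗ[B] p.asIdeal.ResidueField) := by
  -- Smoothness makes the stalk of Ω free, so its rank survives base change to the residue field κ;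
  -- the maps from Ω to κ form the dual of that fibre.
  have hfree : Module.Free (Localization.AtPrime p.asIdeal)
      (LocalizedModule p.asIdeal.primeCompl Ω[B⁄K]) := by
    have h : p ∈ Algebra.smoothLocus K B := hp
    rw [Algebra.smoothLocus_eq_compl_support_inter] at h
    exact h.2
  let e : LocalizedModule p.asIdeal.primeCompl Ω[B⁄K] ≃ₗ[Localization.AtPrime p.asIdeal]
      Localization.AtPrime p.asIdeal ⊗[B] Ω[B⁄K] :=
    LocalizedModule.equivTensorProduct p.asIdeal.primeCompl _
  have := Module.Free.of_equiv e
  let e' : p.asIdeal.ResidueField ⊗[Localization.AtPrime p.asIdeal]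
      (Localization.AtPrime p.asIdeal ⊗[B] Ω[B⁄K]) ≃ₗ[p.asIdeal.ResidueField]
      p.asIdeal.ResidueField ⊗[B] Ω[B⁄K] :=
    TensorProduct.AlgebraTensorModule.cancelBaseChange _ _ _ _ _
  let e'' : (Ω[B⁄K] →ₗ[B] p.asIdeal.ResidueField) ≃ₗ[p.asIdeal.ResidueField]
      Module.Dual p.asIdeal.ResidueField (p.asIdeal.ResidueField ⊗[B] Ω[B⁄K]) :=
    LinearMap.liftBaseChangeEquiv p.asIdeal.ResidueField
  rw [e''.finrank_eq, Subspace.dual_finrank_eq, ← e'.finrank_eq, Module.finrank_baseChange,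
    Module.rankAtStalk_eq_finrank_tensorProduct]

/-! ### Derivations into the residue field. -/

section Derivation

variable {K A κ : Type*} [Field K] [CommRing A] [Algebra K A] [Field κ] [Algebra K κ]

/-- A derivation killing an ideal that acts trivially descends to the quotient. -/
def Derivation.ofQuotient {I : Ideal A} [Algebra A κ] [Algebra (A ⧸ I) κ]
    [IsScalarTower A (A ⧸ I) κ]
    (d : Derivation K A κ) (hd : ∀ a ∈ I, d a = 0) : Derivation K (A ⧸ I) κ :=
  Derivation.mk' (Submodule.liftQ (I.restrictScalars K) d.toLinearMap hd : (A ⧸ I) →ₗ[K] κ) <| by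
    intro a b
    obtain ⟨a, rfl⟩ := Ideal.Quotient.mk_surjective a
    obtain ⟨b, rfl⟩ := Ideal.Quotient.mk_surjective b
    change d (a * b) = algebraMap A (A ⧸ I) a • d b + algebraMap A (A ⧸ I) b • d a
    rw [algebraMap_smul, algebraMap_smul, d.leibniz]

theorem Derivation.ofQuotient_mk {I : Ideal A} [Algebra A κ] [Algebra (A ⧸ I) κ]
    [IsScalarTower A (A ⧸ I) κ]
    (d : Derivation K A κ) (hd : ∀ a ∈ I, d a = 0) (a : A) :
    Derivation.ofQuotient d hd (Ideal.Quotient.mk I a) = d a := rfl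

theorem Derivation.eq_zero_of_mem_span {s : Set A} [Algebra A κ] (d : Derivation K A κ)
    (hs : ∀ a ∈ s, algebraMap A κ a = 0) (hd : ∀ a ∈ s, d a = 0) :
    ∀ a ∈ Ideal.span s, d a = 0 := by
  intro a ha
  induction ha using Submodule.span_induction with
  | mem x h => exact hd x h
  | zero => simp
  | add x y _ _ hx hy => simp [hx, hy]
  | smul r x hx h =>
    have h0 : algebraMap A κ x = 0 := by
      have : Ideal.span s ≤ RingHom.ker (algebraMap A κ) := Ideal.span_le.2 hs
      exact this hx
    simp [h, Algebra.smul_def, h0]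

/-- Derivations of A killing I descend to A/I, so W embeds into the maps from Ω to the residue
field, a space whose dimension is the rank at a smooth point. -/
theorem finrank_le_rankAtStalk_of_derivations {K A : Type*} [Field K] [CommRing A] [Algebra K A]
    [Algebra.FiniteType K A] (I : Ideal A) (p : PrimeSpectrum (A ⧸ I))
    (hp : Algebra.IsSmoothAt K p.asIdeal) {W : Type*} [AddCommGroup W]
    [Module p.asIdeal.ResidueField W] (d : W → Derivation K A p.asIdeal.ResidueField)
    (hI : ∀ u, ∀ a ∈ I, d u a = 0) (hadd : ∀ u v a, d (u + v) a = d u a + d v a)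
    (hsmul : ∀ (c : p.asIdeal.ResidueField) u a, d (c • u) a = c * d u a)
    (hinj : ∀ u, (∀ a, d u a = 0) → u = 0) :
    Module.finrank p.asIdeal.ResidueField W ≤
      Module.rankAtStalk (R := A ⧸ I) Ω[A ⧸ I⁄K] p := by
  rw [rankAtStalk_kaehlerDifferential_eq_finrank p hp]
  have hDX (u : W) (a : A) : (Derivation.ofQuotient (d u) (hI u)).liftKaehlerDifferential
        (KaehlerDifferential.D K _ (Ideal.Quotient.mk _ a)) = d u a := by
    rw [Derivation.liftKaehlerDifferential_comp_D, Derivation.ofQuotient_mk]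
  have hext {f g : Ω[A ⧸ I⁄K] →ₗ[A ⧸ I] p.asIdeal.ResidueField}
      (h : ∀ a, f (KaehlerDifferential.D K _ (Ideal.Quotient.mk _ a)) =
        g (KaehlerDifferential.D K _ (Ideal.Quotient.mk _ a))) : f = g := by
    apply Derivation.liftKaehlerDifferential_unique
    ext b
    obtain ⟨a, rfl⟩ := Ideal.Quotient.mk_surjective b
    exact h a
  let T : W →ₗ[p.asIdeal.ResidueField] (Ω[A ⧸ I⁄K] →ₗ[A ⧸ I] p.asIdeal.ResidueField) :=
    { toFun u := (Derivation.ofQuotient (d u) (hI u)).liftKaehlerDifferential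
      map_add' u v := hext fun a => by
        rw [LinearMap.add_apply, hDX, hDX, hDX, hadd]
      map_smul' c u := hext fun a => by
        rw [LinearMap.smul_apply, hDX, RingHom.id_apply, hDX, hsmul, smul_eq_mul] }
  have hT : Function.Injective T := by
    rw [injective_iff_map_eq_zero]
    intro u hu
    refine hinj u fun a => ?_
    have h0 : (Derivation.ofQuotient (d u) (hI u)).liftKaehlerDifferential = 0 := hu
    rw [← hDX, h0, LinearMap.zero_apply]
  have : Module.Finite p.asIdeal.ResidueField
      (Ω[A ⧸ I⁄K] →ₗ[A ⧸ I] p.asIdeal.ResidueField) :=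
    Module.Finite.equiv (LinearMap.liftBaseChangeEquiv p.asIdeal.ResidueField).symm
  exact LinearMap.finrank_le_finrank_of_injective hT

end Derivation


/-! ### A relation between the differentials obstructs smoothness. -/

section Singular

variable {K : Type*} [Field K] {N : ℕ} {ι : Type*}

/-- The `K`-point `x` is a common zero of the `F i` where the coefficients `μ` give a linear
relation between the differentials of the `F i`. -/
def IsSing [Fintype ι] {n : Type*} (F : ι → MvPolynomial n K) (x : n → K) (μ : ι → K) : Prop :=
  (∀ i, eval x (F i) = 0) ∧ ∀ l, ∑ i, μ i * eval x (pderiv l (F i)) = 0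

theorem isScalarTower_quotient_residueField {A : Type*} [CommRing A] (I : Ideal A)
    (p : PrimeSpectrum (A ⧸ I)) : IsScalarTower A (A ⧸ I) p.asIdeal.ResidueField := inferInstance

instance (F : ι → MvPolynomial (Fin (N + 1)) K) (j : Fin (N + 1))
    (p : PrimeSpectrum (ChartRing F j)) :
    IsScalarTower (MvPolynomial (Fin (N + 1)) K) (ChartRing F j) p.asIdeal.ResidueField :=
  isScalarTower_quotient_residueField _ p

theorem mkDerivation_eq_sum {n B : Type*} [Fintype n] [CommRing B] [Algebra K B]
    [Algebra (MvPolynomial n K) B] [IsScalarTower K (MvPolynomial n K) B] (u : n → B)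
    (a : MvPolynomial n K) :
    mkDerivation K u a = ∑ l, u l * algebraMap (MvPolynomial n K) B (pderiv l a) := by
  classical
  induction a using MvPolynomial.induction_on with
  | C a => simp
  | add p q hp hq => simp [hp, hq, mul_add, Finset.sum_add_distrib]
  | mul_X p i hp =>
    simp only [Derivation.leibniz, mkDerivation_X, hp, pderiv_X, smul_eq_mul, map_add, map_mul,
      mul_add, Finset.sum_add_distrib, Algebra.smul_def, Finset.mul_sum]
    congr 1
    · rw [Finset.sum_eq_single i (by intro b _ hb; simp [Pi.single_eq_of_ne' hb]) (by simp)]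
      simp [mul_comm]
    · exact Finset.sum_congr rfl fun _ _ => by ring

section

variable {n κ : Type*} [Field κ] [Algebra K κ] [Algebra (MvPolynomial n K) κ]
  [IsScalarTower K (MvPolynomial n K) κ]

theorem mkDerivation_add_apply [Fintype n] (u v : n → κ) (a : MvPolynomial n K) :
    mkDerivation K (u + v) a = mkDerivation K u a + mkDerivation K v a := by
  simp only [mkDerivation_eq_sum, ← Finset.sum_add_distrib, Pi.add_apply, add_mul]

theorem mkDerivation_smul_apply [Fintype n] (c : κ) (u : n → κ) (a : MvPolynomial n K) :
    mkDerivation K (c • u) a = c * mkDerivation K u a := by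
  simp only [mkDerivation_eq_sum, Finset.mul_sum, Pi.smul_apply, smul_eq_mul, mul_assoc]

theorem eq_zero_of_mkDerivation (u : n → κ) (h : ∀ a, mkDerivation K u a = 0) : u = 0 := by
  ext l
  simpa using h (X l)

theorem mkDerivation_eq_zero_of_mem_span [Fintype n] {F : ι → MvPolynomial n K} {j : n} (u : n → κ)
    (hev : ∀ a ∈ insert (X j - 1) (Set.range F), algebraMap (MvPolynomial n K) κ a = 0)
    (hj : u j = 0) (hF : ∀ i, ∑ l, u l * algebraMap _ κ (pderiv l (F i)) = 0) :
    ∀ a ∈ Ideal.span (insert (X j - 1) (Set.range F)), mkDerivation K u a = 0 := by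
  refine Derivation.eq_zero_of_mem_span _ hev ?_
  rintro a (rfl | ⟨i, rfl⟩)
  · simp [hj]
  · rw [mkDerivation_eq_sum, hF i]

end

/-- A tangent vector u gives the derivation ∑ u_l ∂_l, which kills the equations of the chart. -/
theorem finrank_tangentSpace_le (F : ι → MvPolynomial (Fin (N + 1)) K) (j : Fin (N + 1))
    (p : PrimeSpectrum (ChartRing F j)) (hp : Algebra.IsSmoothAt K p.asIdeal)
    (W : Submodule p.asIdeal.ResidueField (Fin (N + 1) → p.asIdeal.ResidueField))
    (hWj : ∀ u ∈ W, u j = 0)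
    (hWF : ∀ u ∈ W, ∀ i, ∑ l, u l * algebraMap _ p.asIdeal.ResidueField (pderiv l (F i)) = 0) :
    Module.finrank p.asIdeal.ResidueField W ≤
      Module.rankAtStalk (R := ChartRing F j) Ω[ChartRing F j⁄K] p := by
  have hev : ∀ a ∈ insert (X j - 1) (Set.range F),
      algebraMap (MvPolynomial (Fin (N + 1)) K) p.asIdeal.ResidueField a = 0 := by
    intro a ha
    rw [IsScalarTower.algebraMap_apply _ (ChartRing F j) p.asIdeal.ResidueField]
    rw [Ideal.Quotient.algebraMap_eq, Ideal.Quotient.eq_zero_iff_mem.2 (Ideal.subset_span ha),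
      map_zero]
  exact finrank_le_rankAtStalk_of_derivations _ p hp
    (fun u : W => mkDerivation K (u : Fin (N + 1) → p.asIdeal.ResidueField))
    (fun u => mkDerivation_eq_zero_of_mem_span _ hev (hWj u u.2) (hWF u u.2))
    (fun u v => mkDerivation_add_apply _ _)
    (fun c u => mkDerivation_smul_apply _ _)
    (fun u hu => Subtype.ext (eq_zero_of_mkDerivation _ hu))

/-- If μ_k ≠ 0, the k-th tangency equation follows from the others, so u_j = 0 can take its place
without raising the number of equations. -/
theorem card_le_finrank_tangent_add [Fintype ι] {n κ : Type*} [Fintype n] [Field κ]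
    (M : ι → n → κ) (j : n)
    {μ : ι → κ} (hμ : μ ≠ 0) (hM : ∀ l, ∑ i, μ i * M i l = 0) :
    ∃ W : Submodule κ (n → κ), (∀ u ∈ W, u j = 0) ∧ (∀ u ∈ W, ∀ i, ∑ l, u l * M i l = 0) ∧
      Fintype.card n ≤ Module.finrank κ W + Fintype.card ι := by
  classical
  obtain ⟨k, hk⟩ := Function.ne_iff.1 hμ
  simp only [Pi.zero_apply] at hk
  let f : (n → κ) →ₗ[κ] (ι → κ) := LinearMap.pi fun i =>
    if i = k then LinearMap.proj j else ∑ l, M i l • LinearMap.proj l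
  refine ⟨LinearMap.ker f, ?_, ?_, ?_⟩
  · intro u hu
    simpa [f] using congrFun (LinearMap.mem_ker.1 hu) k
  · intro u hu
    have h1 : ∀ i, i ≠ k → ∑ l, u l * M i l = 0 := fun i hi => by
      have := congrFun (LinearMap.mem_ker.1 hu) i
      simp only [LinearMap.pi_apply, if_neg hi, f, Pi.zero_apply, LinearMap.sum_apply,
        LinearMap.smul_apply, LinearMap.proj_apply, smul_eq_mul] at this
      simpa only [mul_comm] using this
    intro i
    by_cases hi : i = k
    · subst hi
      have h2 : ∑ i', μ i' * ∑ l, u l * M i' l = 0 := by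
        simp_rw [Finset.mul_sum]
        rw [Finset.sum_comm]
        refine Finset.sum_eq_zero fun l _ => ?_
        rw [← mul_zero (u l), ← hM l, Finset.mul_sum]
        exact Finset.sum_congr rfl fun _ _ => by ring
      rw [Finset.sum_eq_single i (fun b _ hb => by rw [h1 b hb, mul_zero]) (by simp)] at h2
      exact (mul_eq_zero.1 h2).resolve_left hk
    · exact h1 i hi
  · have h1 := LinearMap.finrank_range_add_finrank_ker f
    have h2 := Submodule.finrank_le (LinearMap.range f)
    rw [Module.finrank_fintype_fun_eq_card] at h1 h2
    omega

/-- With c forms, the relation forces a tangent space of dimension at least N + 1 - c, whereas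
smoothness of codimension c allows only N - c. -/
theorem IsSing.isSingularPoint_of_eq_one [Fintype ι] {F : ι → MvPolynomial (Fin (N + 1)) K}
    {x : Fin (N + 1) → K} {μ : ι → K} (h : IsSing F x μ) (hμ : μ ≠ 0) {j : Fin (N + 1)}
    (hj : x j = 1) : ∃ p : PrimeSpectrum (ChartRing F j),
      (∀ G : MvPolynomial (Fin (N + 1)) K,
        Ideal.Quotient.mk _ G ∈ p.asIdeal ↔ eval x G = 0) ∧
      ¬ IsSmoothOfCodimAt F (Fintype.card ι) j p := by
  have hI : ∀ a ∈ Ideal.span (insert (X j - 1) (Set.range F)), eval x a = 0 := by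
    have : Ideal.span (insert (X j - 1) (Set.range F)) ≤ RingHom.ker (eval x) := by
      rw [Ideal.span_le]
      rintro a (rfl | ⟨i, rfl⟩)
      · simp [RingHom.mem_ker, hj]
      · exact h.1 i
    exact fun a ha => this ha
  obtain ⟨p, hp⟩ : ∃ p : PrimeSpectrum (ChartRing F j), ∀ G : MvPolynomial (Fin (N + 1)) K,
      Ideal.Quotient.mk _ G ∈ p.asIdeal ↔ eval x G = 0 :=
    ⟨⟨RingHom.ker (Ideal.Quotient.lift _ (eval x) hI), RingHom.ker_isPrime _⟩, fun G => Iff.rfl⟩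
  refine ⟨p, hp, ?_⟩
  rintro ⟨hs, hr⟩
  have hev (a : MvPolynomial (Fin (N + 1)) K) :
      algebraMap (MvPolynomial (Fin (N + 1)) K) p.asIdeal.ResidueField a =
        algebraMap K p.asIdeal.ResidueField (eval x a) := by
    rw [IsScalarTower.algebraMap_apply _ (ChartRing F j) p.asIdeal.ResidueField,
      IsScalarTower.algebraMap_apply K (ChartRing F j) p.asIdeal.ResidueField,
      ← sub_eq_zero, ← map_sub, Ideal.algebraMap_residueField_eq_zero]
    change Ideal.Quotient.mk _ (a - C (eval x a)) ∈ p.asIdeal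
    rw [hp]
    simp
  have hμ' : (fun i => algebraMap K p.asIdeal.ResidueField (μ i)) ≠ 0 := by
    obtain ⟨k, hk⟩ := Function.ne_iff.1 hμ
    exact Function.ne_iff.2 ⟨k, by simpa using hk⟩
  obtain ⟨W, hW1, hW2, hW3⟩ := card_le_finrank_tangent_add
    (fun i l => algebraMap (MvPolynomial (Fin (N + 1)) K) p.asIdeal.ResidueField (pderiv l (F i)))
    j hμ' (fun l => by
      simp_rw [hev, ← map_mul, ← map_sum]
      rw [h.2 l, map_zero])
  have := finrank_tangentSpace_le F j p hs W hW1 hW2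
  rw [Fintype.card_fin] at hW3
  omega

end Singular

/-! ### The Jacobian criterion. -/

open scoped TensorProduct in
/-- The rank of the differentials at a prime can be computed on a basic open neighbourhood on which
the algebra is standard smooth. -/
theorem rankAtStalk_kaehlerDifferential_eq_of_isStandardSmooth {K B : Type*} [Field K]
    [CommRing B] [Algebra K B] (g : B) (p : PrimeSpectrum B) (hg : g ∉ p.asIdeal) (d : ℕ)
    [Algebra.IsStandardSmoothOfRelativeDimension d K (Localization.Away g)] :
    Module.rankAtStalk (R := B) Ω[B⁄K] p = d := by
  have hp' : Submonoid.powers g ≤ p.asIdeal.primeCompl := by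
    simpa [Submonoid.powers_le, Ideal.primeCompl] using hg
  let L := Localization.AtPrime p.asIdeal
  let T := Localization.Away g
  let : Algebra T L :=
    IsLocalization.localizationAlgebraOfSubmonoidLe _ _ (.powers g) p.asIdeal.primeCompl hp'
  have : IsScalarTower B T L :=
    IsLocalization.localization_isScalarTower_of_submonoid_le ..
  have : Nontrivial T := (algebraMap T L).domain_nontrivial
  have hrank := Algebra.IsStandardSmoothOfRelativeDimension.rank_kaehlerDifferential
    (R := K) (S := T) d
  have : Algebra.IsStandardSmooth K T :=
    Algebra.IsStandardSmoothOfRelativeDimension.isStandardSmooth d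
  have hbc := IsLocalizedModule.isBaseChange (.powers g) T (KaehlerDifferential.map K K B T)
  -- Ω[T⁄K] is the localization of Ω[B⁄K], so the stalk at p is also a base change of Ω[T⁄K], whose
  -- rank is known.
  let e1 : L ⊗[T] (T ⊗[B] Ω[B⁄K]) ≃ₗ[L] L ⊗[B] Ω[B⁄K] :=
    TensorProduct.AlgebraTensorModule.cancelBaseChange _ _ _ _ _
  let e2 : L ⊗[T] (T ⊗[B] Ω[B⁄K]) ≃ₗ[L] L ⊗[T] Ω[T⁄K] :=
    TensorProduct.AlgebraTensorModule.congr (LinearEquiv.refl L L) hbc.equiv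
  rw [Module.rankAtStalk_eq_finrank_tensorProduct, ← e1.finrank_eq, e2.finrank_eq,
    Module.finrank_baseChange]
  exact Module.finrank_eq_of_rank_eq hrank

/-- The Jacobian criterion at a prime not containing a maximal minor. -/
theorem isSmoothAt_of_jacobian_notMem {K : Type*} [Field K] {n σ : Type*} [Fintype n] [Fintype σ]
    [DecidableEq σ] (v : σ → MvPolynomial n K) (a : σ → n) (ha : Function.Injective a)
    (p : PrimeSpectrum (MvPolynomial n K ⧸ Ideal.span (Set.range v)))
    (hp : Ideal.Quotient.mk _ (Matrix.of fun i j => pderiv (a i) (v j)).det ∉ p.asIdeal) :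
    Algebra.IsSmoothAt K p.asIdeal ∧
      Module.rankAtStalk (R := MvPolynomial n K ⧸ Ideal.span (Set.range v))
        Ω[MvPolynomial n K ⧸ Ideal.span (Set.range v)⁄K] p + Fintype.card σ = Fintype.card n := by
  let P : Algebra.PreSubmersivePresentation K (MvPolynomial n K ⧸ Ideal.span (Set.range v)) n σ :=
    Algebra.PreSubmersivePresentation.naive a ha
  have hg : P.jacobian ∉ p.asIdeal := by
    have h : P.jacobiMatrix = Matrix.of fun i j => pderiv (a i) (v j) := by
      exact Matrix.ext fun i j => P.jacobiMatrix_apply i j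
    rw [Algebra.PreSubmersivePresentation.jacobian_eq_jacobiMatrix_det, h]
    have h2 : ∀ q : MvPolynomial n K, algebraMap P.Ring
        (MvPolynomial n K ⧸ Ideal.span (Set.range v)) q = Ideal.Quotient.mk _ q := by
      intro q
      rw [Algebra.Generators.algebraMap_apply]
      change aeval (fun i => Ideal.Quotient.mk (Ideal.span (Set.range v)) (X i)) q = _
      have h3 : aeval (fun i => Ideal.Quotient.mk (Ideal.span (Set.range v)) (X i)) =
          Ideal.Quotient.mkₐ K (Ideal.span (Set.range v)) := by
        ext i
        simp
      rw [h3]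
      rfl
    rw [h2]
    exact hp
  let g := P.jacobian
  let T := Localization.Away g
  -- Inverting the Jacobian adds one variable and one equation, so the presentation becomes
  -- submersive and its dimension is unchanged.
  let Q := (Algebra.PreSubmersivePresentation.localizationAway T g).comp P
  have hQ : IsUnit Q.jacobian := by
    rw [Algebra.PreSubmersivePresentation.comp_jacobian_eq_jacobian_smul_jacobian,
      Algebra.PreSubmersivePresentation.localizationAway_jacobian, Algebra.smul_def]
    exact (IsLocalization.Away.algebraMap_isUnit g).mul (IsLocalization.Away.algebraMap_isUnit g)
  have hle : Fintype.card σ ≤ Fintype.card n := Fintype.card_le_of_injective a ha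
  have : Algebra.IsStandardSmoothOfRelativeDimension (Fintype.card n - Fintype.card σ) K T :=
    (⟨Q, hQ⟩ : Algebra.SubmersivePresentation K T (Unit ⊕ n)
      (Unit ⊕ σ)).isStandardSmoothOfRelativeDimension (by
        simp only [Algebra.Presentation.dimension, Nat.card_eq_fintype_card, Fintype.card_sum]
        omega)
  have hss : Algebra.IsStandardSmooth K T :=
    Algebra.IsStandardSmoothOfRelativeDimension.isStandardSmooth
      (Fintype.card n - Fintype.card σ)
  constructor
  · have : Algebra.FinitePresentation K (MvPolynomial n K ⧸ Ideal.span (Set.range v)) :=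
      Algebra.FinitePresentation.quotient
        (Submodule.fg_def.2 ⟨_, Set.finite_range v, rfl⟩)
    have h := (Algebra.basicOpen_subset_smoothLocus_iff (R := K) (f := g)).2 inferInstance
    exact h hg
  · rw [rankAtStalk_kaehlerDifferential_eq_of_isStandardSmooth g p hg
      (Fintype.card n - Fintype.card σ)]
    omega


/-- A matrix with independent rows over a field has a nonzero maximal minor. -/
theorem Matrix.exists_det_submatrix_ne_zero {K n σ : Type*} [Field K] [Fintype n] [Fintype σ]
    [DecidableEq σ] (M : Matrix σ n K) (hM : ∀ μ : σ → K, (∀ l, ∑ i, μ i * M i l = 0) → μ = 0) :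
    ∃ a : σ → n, (M.submatrix id a).det ≠ 0 := by
  have hli : LinearIndependent K M.row := by
    rw [Fintype.linearIndependent_iff]
    intro g hg i
    exact congrFun (hM g fun l => by simpa using congrFun hg l) i
  have hspan : Submodule.span K (Set.range M.col) = ⊤ := by
    apply Submodule.eq_top_of_finrank_eq
    rw [← Matrix.rank_eq_finrank_span_cols, hli.rank_matrix, Module.finrank_fintype_fun_eq_card]
  obtain ⟨κ, a, ha, hs, hl⟩ := exists_linearIndependent' K M.col
  rw [hspan] at hs
  have : Fintype κ := Fintype.ofInjective a ha
  have hcard : Fintype.card σ = Fintype.card κ := by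
    rw [← Module.finrank_fintype_fun_eq_card K (η := σ), ← finrank_top, ← hs,
      finrank_span_eq_card hl]
  let e : σ ≃ κ := Fintype.equivOfCardEq hcard
  refine ⟨a ∘ e, ?_⟩
  have h2 : LinearIndependent K (M.submatrix id (a ∘ e)).col := hl.comp e e.injective
  rw [Matrix.linearIndependent_cols_iff_isUnit, Matrix.isUnit_iff_isUnit_det] at h2
  exact h2.ne_zero

/-- Nullstellensatz: a prime is the vanishing ideal of its zero locus. -/
theorem exists_mem_zeroLocus_of_isPrime {K : Type*} [Field K] [IsAlgClosed K] {n : Type*} [Finite n]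
    (P : Ideal (MvPolynomial n K)) [hP : P.IsPrime] {h : MvPolynomial n K} (hh : h ∉ P) :
    ∃ y : n → K, (∀ f ∈ P, eval y f = 0) ∧ eval y h ≠ 0 := by
  by_contra! hc
  refine hh ?_
  rw [← IsPrime.vanishingIdeal_zeroLocus (K := K) P, mem_vanishingIdeal_iff]
  intro y hy
  simpa [aeval_eq_eval] using hc y fun f hf => by simpa [aeval_eq_eval] using hy f hf

section

variable {K : Type*} [Field K]

/-- It suffices to test one K-point y in the closure of p: a maximal minor that is nonzero at y
cannot lie in p. -/
theorem isSmoothAt_of_forall_linearIndependent [IsAlgClosed K] {n σ : Type*} [Fintype n] [Fintype σ]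
    (v : σ → MvPolynomial n K)
    (hv : ∀ y, (∀ i, eval y (v i) = 0) → ∀ μ : σ → K,
      (∀ l, ∑ i, μ i * eval y (pderiv l (v i)) = 0) → μ = 0)
    (p : PrimeSpectrum (MvPolynomial n K ⧸ Ideal.span (Set.range v))) :
    Algebra.IsSmoothAt K p.asIdeal ∧
      Module.rankAtStalk (R := MvPolynomial n K ⧸ Ideal.span (Set.range v))
        Ω[MvPolynomial n K ⧸ Ideal.span (Set.range v)⁄K] p + Fintype.card σ = Fintype.card n := by
  classical
  suffices ∃ a : σ → n, Function.Injective a ∧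
      Ideal.Quotient.mk _ (Matrix.of fun i j => pderiv (a i) (v j)).det ∉ p.asIdeal by
    obtain ⟨a, ha, h⟩ := this
    exact isSmoothAt_of_jacobian_notMem v a ha p h
  obtain ⟨y, hy, -⟩ := exists_mem_zeroLocus_of_isPrime
    (p.asIdeal.comap (Ideal.Quotient.mk (Ideal.span (Set.range v)))) (h := 1)
    (by rw [← Ideal.eq_top_iff_one]; exact Ideal.IsPrime.ne_top inferInstance)
  have hy0 : ∀ i, eval y (v i) = 0 := fun i => hy _ (by
    rw [Ideal.mem_comap,
      Ideal.Quotient.eq_zero_iff_mem.2 (Ideal.subset_span (Set.mem_range_self i))]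
    exact zero_mem _)
  obtain ⟨a, ha⟩ := Matrix.exists_det_submatrix_ne_zero
    (Matrix.of fun i l => eval y (pderiv l (v i))) (hv y hy0)
  refine ⟨a, ?_, fun hmem => ha ?_⟩
  -- A repeated index would give the minor two equal columns.
  · intro i i' hii
    by_contra hne
    exact ha (Matrix.det_zero_of_column_eq hne fun k => by simp [hii])
  · have := hy _ (Ideal.mem_comap.2 hmem)
    rw [RingHom.map_det, ← Matrix.det_transpose] at this
    convert this using 2
    ext
    rfl

theorem MvPolynomial.IsHomogeneous.eval_smul {R n : Type*} [CommRing R]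
    {f : MvPolynomial n R} {d : ℕ}
    (hf : f.IsHomogeneous d) (c : R) (x : n → R) : eval (c • x) f = c ^ d * eval x f := by
  rw [eval_eq, eval_eq, Finset.mul_sum]
  refine Finset.sum_congr rfl fun m hm => ?_
  have h := hf.degree_eq_sum_deg_support hm
  simp only [Pi.smul_apply, smul_eq_mul, mul_pow, Finset.prod_mul_distrib,
    Finset.prod_pow_eq_pow_sum]
  rw [← h]
  ring

theorem MvPolynomial.IsHomogeneous.sum_mul_eval_pderiv {R n : Type*} [CommRing R] [Fintype n]
    {f : MvPolynomial n R} {d : ℕ} (hf : f.IsHomogeneous d) {x : n → R} (hx : eval x f = 0) :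
    ∑ l, x l * eval x (pderiv l f) = 0 := by
  have := congrArg (eval x) hf.sum_X_mul_pderiv
  simpa [hx] using this

variable {N : ℕ} {ι : Type*} [Fintype ι]

/-- The projective Jacobian criterion: a complete intersection without singular `K`-points is smooth
of the expected codimension. -/
theorem isSmoothOfCodim_of_forall_isSing [IsAlgClosed K]
    {F : ι → MvPolynomial (Fin (N + 1)) K} {d : ι → ℕ}
    (hF : ∀ i, (F i).IsHomogeneous (d i)) (h : ∀ x ≠ 0, ∀ μ, IsSing F x μ → μ = 0) :
    IsSmoothOfCodim F (Fintype.card ι) := by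
  intro j
  -- The chart is cut out in affine space by the F_i and the extra equation X_j - 1, indexed by
  -- `none`.
  let v : Option ι → MvPolynomial (Fin (N + 1)) K := fun o => o.elim (X j - 1) F
  have hv : ∀ y, (∀ i, eval y (v i) = 0) → ∀ μ : Option ι → K,
      (∀ l, ∑ i, μ i * eval y (pderiv l (v i)) = 0) → μ = 0 := by
    intro y hy μ hμ
    have hyj : y j = 1 := by simpa [v, sub_eq_zero] using hy none
    have hyF : ∀ i, eval y (F i) = 0 := fun i => hy (some i)
    simp only [Fintype.sum_option, v, Option.elim_none, Option.elim_some] at hμ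
    -- Pair the relation with y: Euler's relation kills the terms of the F_i, which vanish at y, and
    -- leaves μ none * y_j = μ none.
    have h0 : μ none = 0 := by
      have h1 : ∑ l, y l * (μ none * eval y (pderiv l (X j - 1)) +
          ∑ i, μ (some i) * eval y (pderiv l (F i))) = 0 :=
        Finset.sum_eq_zero fun l _ => by rw [hμ l, mul_zero]
      simp only [mul_add, Finset.sum_add_distrib] at h1
      have h2 : ∑ l, y l * ∑ i, μ (some i) * eval y (pderiv l (F i)) = 0 := by
        simp_rw [Finset.mul_sum]
        rw [Finset.sum_comm]
        refine Finset.sum_eq_zero fun i _ => ?_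
        rw [← mul_zero (μ (some i)), ← (hF i).sum_mul_eval_pderiv (hyF i), Finset.mul_sum]
        exact Finset.sum_congr rfl fun _ _ => by ring
      rw [h2, add_zero, Finset.sum_eq_single j
        (fun b _ hb => by simp [pderiv_X, Pi.single_eq_of_ne' hb]) (by simp)] at h1
      simpa [hyj] using h1
    have h1 := h y (fun h => by simp [h] at hyj) (fun i => μ (some i))
      ⟨hyF, fun l => by simpa [h0] using hμ l⟩
    ext o
    cases o with
    | none => exact h0
    | some i => exact congrFun h1 i
  have hS : insert (X j - 1) (Set.range F) = Set.range v := by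
    ext f
    simp [v, Option.exists, eq_comm]
  -- The generating set is a variable here because the quotient ring, and hence p, depends on it;
  -- the equality of sets is then used by substitution.
  have key : ∀ S, S = Set.range v →
      ∀ p : PrimeSpectrum (MvPolynomial (Fin (N + 1)) K ⧸ Ideal.span S),
      Algebra.IsSmoothAt K p.asIdeal ∧
      Module.rankAtStalk (R := MvPolynomial (Fin (N + 1)) K ⧸ Ideal.span S)
        Ω[MvPolynomial (Fin (N + 1)) K ⧸ Ideal.span S⁄K] p + Fintype.card (Option ι) =
          Fintype.card (Fin (N + 1)) := by
    rintro S rfl p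
    exact isSmoothAt_of_forall_linearIndependent v hv p
  intro p
  obtain ⟨h1, h2⟩ := key _ hS p
  rw [Fintype.card_option, Fintype.card_fin] at h2
  exact ⟨h1, Nat.succ.inj h2⟩

/-- Rescale to x_j = 1. The derivatives of F_i have degree d_i - 1, so the resulting factor is
absorbed into μ_i. -/
theorem IsSing.isSingularPoint {F : ι → MvPolynomial (Fin (N + 1)) K} {d : ι → ℕ}
    (hF : ∀ i, (F i).IsHomogeneous (d i)) {x : Fin (N + 1) → K} {μ : ι → K} (h : IsSing F x μ)
    (hμ : μ ≠ 0) (hx : x ≠ 0) : IsSingularPoint F (Fintype.card ι) x := by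
  obtain ⟨j, hj⟩ := Function.ne_iff.1 hx
  have hj : x j ≠ 0 := hj
  have h1 : IsSing F ((x j)⁻¹ • x) fun i => μ i * x j ^ (d i - 1) := by
    refine ⟨fun i => by rw [(hF i).eval_smul, h.1 i, mul_zero], fun l => ?_⟩
    rw [← h.2 l]
    refine Finset.sum_congr rfl fun i _ => ?_
    rw [(hF i).pderiv.eval_smul, mul_assoc, ← mul_assoc (_ ^ _), ← mul_pow, mul_inv_cancel₀ hj,
      one_pow, one_mul]
  have hμ' : (fun i => μ i * x j ^ (d i - 1)) ≠ 0 := by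
    obtain ⟨k, hk⟩ := Function.ne_iff.1 hμ
    exact Function.ne_iff.2 ⟨k, mul_ne_zero hk (pow_ne_zero _ hj)⟩
  obtain ⟨p, hp, hs⟩ := h1.isSingularPoint_of_eq_one hμ' (j := j) (by simp [hj])
  exact ⟨j, p, hj, hp, hs⟩

/-- The polynomials `F i` have a common zero in projective space where their differentials are
dependent. -/
def HasSing (F : ι → MvPolynomial (Fin (N + 1)) K) : Prop :=
  ∃ x ≠ 0, ∃ μ ≠ 0, IsSing F x μ

/-- The bridge from scheme-theoretic smoothness at all primes to a condition on K-points. -/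
theorem isSmoothOfCodim_iff [IsAlgClosed K] {F : ι → MvPolynomial (Fin (N + 1)) K} {d : ι → ℕ}
    (hF : ∀ i, (F i).IsHomogeneous (d i)) :
    IsSmoothOfCodim F (Fintype.card ι) ↔ ¬ HasSing F := by
  constructor
  · rintro h ⟨x, hx, μ, hμ, hs⟩
    obtain ⟨j, p, -, -, hp⟩ := hs.isSingularPoint hF hμ hx
    exact hp (h j p)
  · intro h
    refine isSmoothOfCodim_of_forall_isSing hF fun x hx μ hs => ?_
    by_contra hμ
    exact h ⟨x, hx, μ, hμ, hs⟩

end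

/-! ### Elimination theory. -/

section Elimination

theorem MvPolynomial.homogeneousComponent_mul_of_isHomogeneous {R n : Type*} [CommRing R]
    {q p : MvPolynomial n R} {e : ℕ} (hp : p.IsHomogeneous e) (m : ℕ) :
    homogeneousComponent m (q * p) =
      if e ≤ m then homogeneousComponent (m - e) q * p else 0 := by
  classical
  let := MvPolynomial.gradedAlgebra (σ := n) (R := R)
  have := DirectSum.coe_decompose_mul_of_right_mem (homogeneousSubmodule n R) m (a := q) (b := p) hp
  rw [← decomposition.decompose'_apply, ← decomposition.decompose'_apply]
  exact this

/-- By the Nullstellensatz every variable lies in the radical of I, and a power of the radical lies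
in I. -/
theorem exists_forall_monomial_mem_of_zeroLocus {K n : Type*} [Field K] [IsAlgClosed K] [Finite n]
    (I : Ideal (MvPolynomial n K)) (hI : ∀ x, (∀ f ∈ I, eval x f = 0) → x = 0) :
    ∃ m : ℕ, m ≠ 0 ∧ ∀ s : n →₀ ℕ, s.degree = m → monomial s 1 ∈ I := by
  have hrad : ∀ l, (X l : MvPolynomial n K) ∈ I.radical := by
    intro l
    rw [← vanishingIdeal_zeroLocus_eq_radical (K := K), mem_vanishingIdeal_iff]
    intro x hx
    rw [hI x fun f hf => by simpa [aeval_eq_eval] using hx f hf]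
    simp
  obtain ⟨m, hm⟩ := Ideal.exists_radical_pow_le_of_fg I (IsNoetherian.noetherian _)
  -- The exponent is raised by one to be nonzero: elimination later needs x_l ^ m = 0 to imply x_l =
  -- 0.
  refine ⟨m + 1, by omega, fun s hs => hm (Ideal.pow_le_pow_right (Nat.le_succ m) ?_)⟩
  rw [monomial_eq, map_one, one_mul, ← Nat.succ_eq_add_one] at *
  rw [← hs, Finsupp.degree_apply, ← Finset.prod_pow_eq_pow_sum]
  exact Ideal.prod_mem_prod fun l _ => Ideal.pow_mem_pow (hrad l) _

theorem MvPolynomial.IsHomogeneous.sum_monomial_coeff {R n : Type*} [CommRing R] {m : ℕ}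
    [Fintype {s : n →₀ ℕ // s.degree = m}] {p : MvPolynomial n R} (hp : p.IsHomogeneous m) :
    ∑ s : {s : n →₀ ℕ // s.degree = m}, monomial s.1 (coeff s.1 p) = p := by
  classical
  ext t
  simp only [coeff_sum, coeff_monomial]
  by_cases ht : t.degree = m
  · rw [Finset.sum_eq_single ⟨t, ht⟩ (fun b _ hb => if_neg fun h => hb (Subtype.ext h)) (by simp),
      if_pos rfl]
  · rw [hp.coeff_eq_zero ht]
    exact Finset.sum_eq_zero fun s _ => if_neg fun h => ht (by rw [← h]; exact s.2)

theorem MvPolynomial.IsHomogeneous.eval_eq_sum {R n : Type*} [CommRing R] {m : ℕ}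
    [Fintype {s : n →₀ ℕ // s.degree = m}] {p : MvPolynomial n R} (hp : p.IsHomogeneous m)
    (x : n → R) : eval x p = ∑ s : {s : n →₀ ℕ // s.degree = m},
      coeff s.1 p * s.1.prod fun l k => x l ^ k := by
  conv_lhs => rw [← hp.sum_monomial_coeff]
  simp [eval_monomial]

/-- Elimination theory: if a family of homogeneous polynomials over `A` has no nontrivial common
zero at a specialization `A → K`, then this persists on a neighbourhood of that specialization. -/
theorem exists_forall_no_common_zero {K A n α : Type*} [Field K] [IsAlgClosed K] [CommRing A]
    [Algebra K A] [Finite n] [Finite α] (P : α → MvPolynomial n A) (e : α → ℕ)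
    (hP : ∀ a, (P a).IsHomogeneous (e a)) (φ₀ : A →ₐ[K] K)
    (h₀ : ∀ x, (∀ a, eval x (map (φ₀ : A →+* K) (P a)) = 0) → x = 0) :
    ∃ f : A, φ₀ f ≠ 0 ∧ ∀ φ : A →ₐ[K] K, φ f ≠ 0 →
      ∀ x, (∀ a, eval x (map (φ : A →+* K) (P a)) = 0) → x = 0 := by
  classical
  cases nonempty_fintype α
  obtain ⟨m, hm0, hm⟩ := exists_forall_monomial_mem_of_zeroLocus
    (Ideal.span (Set.range fun a => map (φ₀ : A →+* K) (P a)))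
    (fun x hx => h₀ x fun a => hx _ (Ideal.subset_span (Set.mem_range_self a)))
  have : Finite {s : n →₀ ℕ // s.degree = m} := (Finsupp.finite_of_degree_eq m).to_subtype
  cases nonempty_fintype {s : n →₀ ℕ // s.degree = m}
  have hQ : ∀ s : {s : n →₀ ℕ // s.degree = m}, ∃ Q : α → MvPolynomial n K,
      ∑ a, Q a * map (φ₀ : A →+* K) (P a) = monomial s.1 1 := fun s =>
    Ideal.mem_span_range_iff_exists_fun.1 (hm s.1 s.2)
  choose Q hQ using hQ
  -- Lift to A the membership of each monomial s in the ideal, keeping only the part of degree m; R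
  -- s specializes to s under φ₀.
  let R : {s : n →₀ ℕ // s.degree = m} → MvPolynomial n A := fun s =>
    ∑ a, if e a ≤ m then
      map (algebraMap K A) (homogeneousComponent (m - e a) (Q s a)) * P a else 0
  have hR : ∀ s, (R s).IsHomogeneous m := by
    intro s
    refine IsHomogeneous.sum _ _ _ fun a _ => ?_
    split_ifs with h
    · have := ((homogeneousComponent_isHomogeneous (m - e a) (Q s a)).map
        (algebraMap K A)).mul (hP a)
      rwa [Nat.sub_add_cancel h] at this
    · exact isHomogeneous_zero _ _ _
  have hR0 : ∀ s, map (φ₀ : A →+* K) (R s) = monomial s.1 1 := by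
    intro s
    rw [← homogeneousComponent_eq_self (isHomogeneous_monomial (σ := n) (1 : K) s.2), ← hQ s,
      map_sum, map_sum]
    refine Finset.sum_congr rfl fun a _ => ?_
    rw [homogeneousComponent_mul_of_isHomogeneous ((hP a).map _)]
    split_ifs with h
    · rw [map_mul, map_map]
      have : (φ₀ : A →+* K).comp (algebraMap K A) = RingHom.id K := φ₀.comp_algebraMap
      rw [this, map_id]
    · rw [map_zero]
  -- The coefficients of the R s form a matrix that is the identity at φ₀. Where its determinant is
  -- nonzero, a common zero x kills every R s, hence every monomial of degree m, in particular x_l ^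
  -- m.
  let c : Matrix {s : n →₀ ℕ // s.degree = m} {s : n →₀ ℕ // s.degree = m} A :=
    Matrix.of fun s s' => coeff s'.1 (R s)
  refine ⟨c.det, ?_, ?_⟩
  · have hc : (φ₀ : A →+* K).mapMatrix c = 1 := by
      ext s s'
      change (φ₀ : A →+* K) (coeff s'.1 (R s)) = _
      rw [← coeff_map, hR0,
        coeff_monomial, Matrix.one_apply]
      simp only [Subtype.ext_iff]
    have : (φ₀ : A →+* K) c.det = 1 := by rw [RingHom.map_det, hc, Matrix.det_one]
    change (φ₀ : A →+* K) c.det ≠ 0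
    rw [this]
    exact one_ne_zero
  · intro φ hφ x hx
    have hdet : ((φ : A →+* K).mapMatrix c).det ≠ 0 := by
      rw [← RingHom.map_det]
      exact hφ
    have hzero := Matrix.eq_zero_of_mulVec_eq_zero hdet
      (v := fun s => s.1.prod fun l k => x l ^ k) (by
        ext s
        have h1 : eval x (map (φ : A →+* K) (R s)) = 0 := by
          rw [map_sum, map_sum]
          refine Finset.sum_eq_zero fun a _ => ?_
          split_ifs
          · rw [map_mul, map_mul, hx a, mul_zero]
          · simp
        rw [((hR s).map _).eval_eq_sum] at h1
        simp only [coeff_map] at h1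
        exact h1)
    ext l
    have := congrFun hzero ⟨Finsupp.single l m, by simp⟩
    simpa [Finsupp.prod_single_index, hm0] using this

end Elimination


/-! ### Forms in terms of their coefficients. -/

section Coefficients

variable {N : ℕ} {ι : Type*}

/-- The coefficients of a tuple of forms of degrees `d i` in `N + 1` variables. -/
abbrev CoeffIndex (N : ℕ) {ι : Type*} (d : ι → ℕ) : Type _ :=
  Σ i, {m : Fin (N + 1) →₀ ℕ // m.degree = d i}

instance (m : ℕ) : Fintype {s : Fin (N + 1) →₀ ℕ // s.degree = m} :=
  have : Finite {s : Fin (N + 1) →₀ ℕ // s.degree = m} := (Finsupp.finite_of_degree_eq m).to_subtype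
  Fintype.ofFinite _

variable {d : ι → ℕ} {R S : Type*} [CommRing R] [CommRing S]

/-- The tuple of forms with given coefficients. -/
def ofCoeff (v : CoeffIndex N d → R) (i : ι) : MvPolynomial (Fin (N + 1)) R :=
  ∑ m : {m : Fin (N + 1) →₀ ℕ // m.degree = d i}, monomial m.1 (v ⟨i, m⟩)

theorem isHomogeneous_ofCoeff (v : CoeffIndex N d → R) (i : ι) :
    (ofCoeff v i).IsHomogeneous (d i) :=
  IsHomogeneous.sum _ _ _ fun m _ => isHomogeneous_monomial _ m.2

theorem map_ofCoeff (φ : R →+* S) (v : CoeffIndex N d → R) (i : ι) :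
    map φ (ofCoeff v i) = ofCoeff (fun t => φ (v t)) i := by
  simp [ofCoeff, map_monomial]

theorem coeff_ofCoeff (v : CoeffIndex N d → R) (t : CoeffIndex N d) :
    coeff t.2.1 (ofCoeff v t.1) = v t := by
  classical
  obtain ⟨i, m⟩ := t
  simp only [ofCoeff, coeff_sum, coeff_monomial]
  rw [Finset.sum_eq_single m (fun b _ hb => if_neg fun h => hb (Subtype.ext h)) (by simp),
    if_pos rfl]

theorem ofCoeff_coeff {F : ι → MvPolynomial (Fin (N + 1)) R} (hF : ∀ i, (F i).IsHomogeneous (d i)) :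
    ofCoeff (d := d) (fun t => coeff t.2.1 (F t.1)) = F := by
  ext1 i
  exact (hF i).sum_monomial_coeff

variable {K : Type*} [Field K] [Fintype ι]

/-- Dependence of the differentials is the vanishing of all maximal minors. This eliminates μ and
leaves homogeneous equations in x alone, as elimination requires. -/
theorem hasSing_iff_det [DecidableEq ι] (F : ι → MvPolynomial (Fin (N + 1)) K) :
    HasSing F ↔ ∃ x ≠ 0, (∀ i, eval x (F i) = 0) ∧
      ∀ e : ι → Fin (N + 1), eval x (Matrix.of fun k i => pderiv (e k) (F i)).det = 0 := by
  refine exists_congr fun x => and_congr_right fun _ => ?_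
  constructor
  · rintro ⟨μ, hμ, h1, h2⟩
    refine ⟨h1, fun e => ?_⟩
    rw [RingHom.map_det]
    by_contra hdet
    refine hμ (Matrix.eq_zero_of_mulVec_eq_zero hdet ?_)
    ext k
    simp only [Matrix.mulVec, dotProduct, Pi.zero_apply]
    rw [← h2 (e k)]
    exact Finset.sum_congr rfl fun i _ => mul_comm _ _
  · rintro ⟨h1, h2⟩
    by_contra! hc
    obtain ⟨a, ha⟩ := Matrix.exists_det_submatrix_ne_zero
      (Matrix.of fun i l => eval x (pderiv l (F i))) fun μ hμ => by
        by_contra hμ0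
        exact hc μ hμ0 ⟨h1, hμ⟩
    refine ha ?_
    rw [← h2 a, RingHom.map_det, ← Matrix.det_transpose]
    rfl

theorem isHomogeneous_det_pderiv [DecidableEq ι] {F : ι → MvPolynomial (Fin (N + 1)) R}
    (hF : ∀ i, (F i).IsHomogeneous (d i)) (e : ι → Fin (N + 1)) :
    (Matrix.of fun k i => pderiv (e k) (F i)).det.IsHomogeneous (∑ i, (d i - 1)) := by
  rw [Matrix.det_apply]
  refine IsHomogeneous.sum _ _ _ fun σ _ => ?_
  have h : (∏ i, Matrix.of (fun k i => pderiv (e k) (F i)) (σ i) i).IsHomogeneous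
      (∑ i, (d i - 1)) := IsHomogeneous.prod _ _ _ fun i _ => (hF i).pderiv
  rcases Int.units_eq_one_or (Equiv.Perm.sign σ) with hs | hs
  · rwa [hs, one_smul]
  · rw [hs, Units.neg_smul, one_smul]
    exact h.neg

/-- Nonsingularity is an open condition on the coefficients. -/
theorem exists_forall_not_hasSing [IsAlgClosed K] (v₀ : CoeffIndex N d → K)
    (h₀ : ¬ HasSing (ofCoeff v₀)) :
    ∃ f : MvPolynomial (CoeffIndex N d) K, eval v₀ f ≠ 0 ∧
      ∀ v, eval v f ≠ 0 → ¬ HasSing (ofCoeff v) := by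
  classical
  -- The universal tuple, whose coefficients are independent variables; it specializes to `ofCoeff
  -- v` along `aeval v`.
  let G : ι → MvPolynomial (Fin (N + 1)) (MvPolynomial (CoeffIndex N d) K) :=
    ofCoeff (d := d) X
  let P : ι ⊕ (ι → Fin (N + 1)) → MvPolynomial (Fin (N + 1)) (MvPolynomial (CoeffIndex N d) K) :=
    Sum.elim G fun e => (Matrix.of fun k i => pderiv (e k) (G i)).det
  have hP : ∀ a, (P a).IsHomogeneous (Sum.elim d (fun _ => ∑ i, (d i - 1)) a) := by
    rintro (i | e)
    · exact isHomogeneous_ofCoeff _ i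
    · exact isHomogeneous_det_pderiv (isHomogeneous_ofCoeff _) e
  have hmap : ∀ v, (∃ x ≠ 0, ∀ a, eval x (map ((aeval v :
      MvPolynomial (CoeffIndex N d) K →ₐ[K] K) : MvPolynomial (CoeffIndex N d) K →+* K)
        (P a)) = 0) ↔
      HasSing (ofCoeff v) := by
    intro v
    have hG : ∀ i, map ((aeval v : MvPolynomial (CoeffIndex N d) K →ₐ[K] K) :
        MvPolynomial (CoeffIndex N d) K →+* K) (G i) = ofCoeff v i := by
      intro i
      rw [map_ofCoeff]
      simp
    rw [hasSing_iff_det]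
    simp only [Sum.forall, P, Sum.elim_inl, Sum.elim_inr, hG]
    have hD : ∀ e : ι → Fin (N + 1), map ((aeval v : MvPolynomial (CoeffIndex N d) K →ₐ[K] K) :
        MvPolynomial (CoeffIndex N d) K →+* K) (Matrix.of fun k i => pderiv (e k) (G i)).det =
        (Matrix.of fun k i => pderiv (e k) (ofCoeff v i)).det := by
      intro e
      rw [RingHom.map_det]
      congr 1
      ext1 k i
      change map _ (pderiv (e k) (G i)) = pderiv (e k) (ofCoeff v i)
      rw [← pderiv_map, hG]
    simp only [hD]
  obtain ⟨f, hf0, hf⟩ := exists_forall_no_common_zero P _ hP (aeval v₀) (by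
    intro x hx
    by_contra hx0
    exact h₀ ((hmap v₀).1 ⟨x, hx0, hx⟩))
  refine ⟨f, by simpa [aeval_eq_eval] using hf0, fun v hv hs => ?_⟩
  obtain ⟨x, hx0, hx⟩ := (hmap v).2 hs
  exact hx0 (hf (aeval v) (by simpa [aeval_eq_eval] using hv) x hx)

end Coefficients

/-! ### Solving for the tuples singular at a given point. -/

section Parametrization

variable {N : ℕ} {ι : Type*} {d : ι → ℕ} {R S : Type*} [CommRing R]
  [CommRing S]

/-- The contribution of the coefficient `t` to the value at `x` of the `i`-th form. -/
def valueCoeff [DecidableEq ι] (x : Fin (N + 1) → R) (i : ι) (t : CoeffIndex N d) : R :=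
  if t.1 = i then eval x (monomial t.2.1 1) else 0

/-- The contribution of the coefficient `t` to the `l`-th coordinate of the combination with
coefficients `μ` of the differentials at `x` of the forms. -/
def derivCoeff (x : Fin (N + 1) → R) (μ : ι → R) (l : Fin (N + 1)) (t : CoeffIndex N d) : R :=
  μ t.1 * eval x (pderiv l (monomial t.2.1 1))

theorem eval_ofCoeff [Fintype ι] [DecidableEq ι]
    (v : CoeffIndex N d → R) (x : Fin (N + 1) → R) (i : ι) :
    eval x (ofCoeff v i) = ∑ t, v t * valueCoeff x i t := by
  rw [Fintype.sum_sigma, Finset.sum_eq_single i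
    (fun b _ hb => Finset.sum_eq_zero fun m _ => by simp [valueCoeff, hb]) (by simp)]
  simp [ofCoeff, valueCoeff, eval_monomial]

theorem sum_mul_eval_pderiv_ofCoeff [Fintype ι]
    (v : CoeffIndex N d → R) (x : Fin (N + 1) → R) (μ : ι → R)
    (l : Fin (N + 1)) :
    ∑ i, μ i * eval x (pderiv l (ofCoeff v i)) = ∑ t, v t * derivCoeff x μ l t := by
  rw [Fintype.sum_sigma]
  refine Finset.sum_congr rfl fun i _ => ?_
  simp only [ofCoeff, map_sum, Finset.mul_sum, derivCoeff]
  refine Finset.sum_congr rfl fun m _ => ?_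
  simp only [pderiv_monomial, eval_monomial]
  ring

theorem map_valueCoeff [DecidableEq ι] (φ : R →+* S) (x : Fin (N + 1) → R) (i : ι)
    (t : CoeffIndex N d) :
    φ (valueCoeff x i t) = valueCoeff (fun l => φ (x l)) i t := by
  simp [valueCoeff, eval_monomial, apply_ite φ, Finsupp.prod, map_prod]

theorem map_derivCoeff (φ : R →+* S) (x : Fin (N + 1) → R) (μ : ι → R) (l : Fin (N + 1))
    (t : CoeffIndex N d) :
    φ (derivCoeff x μ l t) = derivCoeff (fun l => φ (x l)) (fun i => φ (μ i)) l t := by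
  simp [derivCoeff, pderiv_monomial, eval_monomial, Finsupp.prod, map_prod]

variable (d)

/-- The coefficients determined by the others when a singular point `x` with `x j = 1` and a
relation `μ` with `μ k = 1` are prescribed. -/
def boundIndex (j : Fin (N + 1)) {k : ι} (hk : 1 ≤ d k) :
    ι ⊕ {l : Fin (N + 1) // l ≠ j} → CoeffIndex N d :=
  Sum.elim (fun i => ⟨i, Finsupp.single j (d i), by simp⟩)
    fun l => ⟨k, Finsupp.single j (d k - 1) + Finsupp.single l.1 1, by
      simp only [map_add, Finsupp.degree_single]; omega⟩

variable {d} {j : Fin (N + 1)} {k : ι} (hk : 1 ≤ d k)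

theorem boundIndex_injective : Function.Injective (boundIndex d j hk) := by
  have hne (l : {l : Fin (N + 1) // l ≠ j}) (m : ℕ) :
      Finsupp.single j m ≠ Finsupp.single j (d k - 1) + Finsupp.single l.1 1 := by
    intro h
    have := DFunLike.congr_fun h l.1
    simp [l.2.symm] at this
  rintro (i | l) (i' | l') h
  · exact congrArg Sum.inl (congrArg Sigma.fst h)
  · obtain rfl : i = k := congrArg Sigma.fst h
    simp only [boundIndex, Sum.elim_inl, Sum.elim_inr, Sigma.mk.injEq, heq_eq_eq, true_and,
      Subtype.mk.injEq] at h
    exact absurd h (hne l' _)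
  · obtain rfl : k = i' := congrArg Sigma.fst h
    simp only [boundIndex, Sum.elim_inl, Sum.elim_inr, Sigma.mk.injEq, heq_eq_eq, true_and,
      Subtype.mk.injEq] at h
    exact absurd h.symm (hne l _)
  · simp only [boundIndex, Sum.elim_inr, Sigma.mk.injEq, heq_eq_eq, true_and,
      Subtype.mk.injEq, add_right_inj] at h
    exact congrArg Sum.inr (Subtype.ext (Finsupp.single_left_injective one_ne_zero h))

/-- In the bound coefficients the linear system is block triangular with identity diagonal blocks:
the ∂_l-equations involve only the X_j^{d_k-1} X_l, and each value equation contains its own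
X_j^{d_i} with coefficient 1. -/
theorem valueCoeff_boundIndex_inl [DecidableEq ι] {x : Fin (N + 1) → R} (hx : x j = 1) (i i' : ι) :
    valueCoeff x i (boundIndex d j hk (Sum.inl i')) = if i' = i then 1 else 0 := by
  simp [valueCoeff, boundIndex, eval_monomial, hx]

theorem eval_single_add_single (x : Fin (N + 1) → R) (j l : Fin (N + 1)) (m : ℕ) :
    eval x (monomial (Finsupp.single j m + Finsupp.single l 1) 1) = x j ^ m * x l := by
  rw [eval_monomial, one_mul, Finsupp.prod_add_index' (by simp) (by simp [pow_add]),
    Finsupp.prod_single_index (by simp), Finsupp.prod_single_index (by simp), pow_one]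

theorem valueCoeff_boundIndex_inr [DecidableEq ι] {x : Fin (N + 1) → R} (hx : x j = 1) (i : ι)
    (l : {l : Fin (N + 1) // l ≠ j}) :
    valueCoeff x i (boundIndex d j hk (Sum.inr l)) = if k = i then x l else 0 := by
  simp only [valueCoeff, boundIndex, Sum.elim_inr, eval_single_add_single, hx, one_pow, one_mul]

theorem derivCoeff_boundIndex_inl (x : Fin (N + 1) → R) (μ : ι → R) (i : ι)
    (l : {l : Fin (N + 1) // l ≠ j}) :
    derivCoeff x μ l (boundIndex d j hk (Sum.inl i)) = 0 := by
  simp [derivCoeff, boundIndex, pderiv_monomial, l.2.symm]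

theorem derivCoeff_boundIndex_inr {x : Fin (N + 1) → R} (hx : x j = 1) {μ : ι → R} (hμ : μ k = 1)
    (l l' : {l : Fin (N + 1) // l ≠ j}) :
    derivCoeff x μ l (boundIndex d j hk (Sum.inr l')) = if l' = l then 1 else 0 := by
  simp only [derivCoeff, boundIndex, Sum.elim_inr, hμ, pderiv_monomial, Finsupp.add_apply,
    Finsupp.single_apply, l.2.symm, if_false, zero_add]
  generalize d k - 1 = m
  by_cases h : l' = l
  · subst h
    simp [eval_monomial, hx]
  · have : l'.1 ≠ l.1 := fun h' => h (Subtype.ext h')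
    simp [h, this]

/-- The coefficients which remain free. -/
abbrev FreeIndex (j : Fin (N + 1)) {k : ι} (hk : 1 ≤ d k) : Type _ :=
  ((Set.range (boundIndex d j hk))ᶜ : Set (CoeffIndex N d))

open Classical in
/-- Splitting the coefficients into bound and free ones. -/
def splitIndex (j : Fin (N + 1)) {k : ι} (hk : 1 ≤ d k) :
    (ι ⊕ {l : Fin (N + 1) // l ≠ j}) ⊕ FreeIndex j hk ≃ CoeffIndex N d :=
  (Equiv.sumCongr (Equiv.ofInjective _ (boundIndex_injective hk)) (Equiv.refl _)).trans
    (Equiv.Set.sumCompl _)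

variable [Fintype ι]

instance : Fintype (FreeIndex j hk) := Fintype.ofFinite _

theorem sum_splitIndex (g : CoeffIndex N d → R) :
    ∑ t, g t = ∑ i, g (boundIndex d j hk (Sum.inl i)) + ∑ l, g (boundIndex d j hk (Sum.inr l)) +
      ∑ f : FreeIndex j hk, g f := by
  rw [← Equiv.sum_comp (splitIndex j hk), Fintype.sum_sum_type, Fintype.sum_sum_type]
  rfl

/-- The bound coefficients of the type `X_j ^ (d k - 1) * X_l` in the `k`-th form. -/
def derivSol (x : Fin (N + 1) → R) (μ : ι → R) (w : FreeIndex j hk → R)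
    (l : {l : Fin (N + 1) // l ≠ j}) : R :=
  -∑ f, w f * derivCoeff x μ l f.1

variable [DecidableEq ι]

/-- The bound coefficients of the type `X_j ^ d i`. -/
def valueSol (x : Fin (N + 1) → R) (μ : ι → R) (w : FreeIndex j hk → R) (i : ι) : R :=
  -((if k = i then ∑ l : {l : Fin (N + 1) // l ≠ j}, derivSol hk x μ w l * x l else 0) +
    ∑ f, w f * valueCoeff x i f.1)

/-- The coefficients of the tuple of forms which is singular at `x` with relation `μ` and has free
coefficients `w`. -/
def singularCoeff (x : Fin (N + 1) → R) (μ : ι → R) (w : FreeIndex j hk → R) :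
    CoeffIndex N d → R :=
  Sum.elim (Sum.elim (valueSol hk x μ w) (derivSol hk x μ w)) w ∘ (splitIndex j hk).symm

/-- Triangularity allows solving the derivative equations first and then the value equations,
without dividing. The equation for l = j is left out; Euler's relation supplies it later. -/
theorem eq_singularCoeff_iff {x : Fin (N + 1) → R} (hx : x j = 1) {μ : ι → R} (hμ : μ k = 1)
    (v : CoeffIndex N d → R) (w : FreeIndex j hk → R) :
    v = singularCoeff hk x μ w ↔ (∀ f : FreeIndex j hk, v f = w f) ∧
      (∀ i, ∑ t, v t * valueCoeff x i t = 0) ∧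
      ∀ l ≠ j, ∑ t, v t * derivCoeff x μ l t = 0 := by
  have h1 : v = singularCoeff hk x μ w ↔
      (∀ i, v (boundIndex d j hk (Sum.inl i)) = valueSol hk x μ w i) ∧
      (∀ l, v (boundIndex d j hk (Sum.inr l)) = derivSol hk x μ w l) ∧
      ∀ f : FreeIndex j hk, v f = w f := by
    rw [singularCoeff, Equiv.eq_comp_symm, funext_iff, Sum.forall, Sum.forall, and_assoc]
    rfl
  have h2 : ∀ i, ∑ t, v t * valueCoeff x i t = v (boundIndex d j hk (Sum.inl i)) +
      ((if k = i then ∑ l : {l : Fin (N + 1) // l ≠ j}, v (boundIndex d j hk (Sum.inr l)) * x l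
        else 0) + ∑ f : FreeIndex j hk, v f * valueCoeff x i f.1) := by
    intro i
    rw [sum_splitIndex (j := j) hk]
    simp only [valueCoeff_boundIndex_inl hk hx, valueCoeff_boundIndex_inr hk hx, mul_ite, mul_one,
      mul_zero, Finset.sum_ite_eq', Finset.mem_univ, if_true, add_assoc]
    split_ifs <;> simp
  have h3 : ∀ l : {l : Fin (N + 1) // l ≠ j}, ∑ t, v t * derivCoeff x μ l t =
      v (boundIndex d j hk (Sum.inr l)) + ∑ f : FreeIndex j hk, v f * derivCoeff x μ l f.1 := by
    intro l
    rw [sum_splitIndex (j := j) hk]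
    simp only [derivCoeff_boundIndex_inl hk, derivCoeff_boundIndex_inr hk hx hμ, mul_ite, mul_one,
      mul_zero, Finset.sum_ite_eq', Finset.mem_univ, if_true, Finset.sum_const_zero, zero_add]
  have h3' : (∀ l ≠ j, ∑ t, v t * derivCoeff x μ l t = 0) ↔
      ∀ l : {l : Fin (N + 1) // l ≠ j}, v (boundIndex d j hk (Sum.inr l)) =
        -∑ f : FreeIndex j hk, v f * derivCoeff x μ l f.1 := by
    simp only [← add_eq_zero_iff_eq_neg, ← h3, Subtype.forall]
  rw [h1, h3']
  simp only [h2, add_eq_zero_iff_eq_neg]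
  constructor
  · rintro ⟨ha, hb, hf⟩
    refine ⟨hf, fun i => ?_, fun l => ?_⟩
    · rw [ha, valueSol]
      simp only [hb, hf]
    · rw [hb, derivSol]
      simp only [hf]
  · rintro ⟨hf, ha, hb⟩
    have hb' : ∀ l, v (boundIndex d j hk (Sum.inr l)) = derivSol hk x μ w l := fun l => by
      rw [hb, derivSol]
      simp only [hf]
    refine ⟨fun i => ?_, hb', hf⟩
    rw [ha, valueSol]
    simp only [hb', hf]

/-- The solution is polynomial in x, μ, w, so the generic solution over a polynomial ring
specializes to every particular one. -/
theorem map_singularCoeff (φ : R →+* S) (x : Fin (N + 1) → R) (μ : ι → R)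
    (w : FreeIndex j hk → R) (t : CoeffIndex N d) :
    φ (singularCoeff hk x μ w t) =
      singularCoeff hk (fun l => φ (x l)) (fun i => φ (μ i)) (fun f => φ (w f)) t := by
  have hb : ∀ l, φ (derivSol hk x μ w l) =
      derivSol hk (fun l => φ (x l)) (fun i => φ (μ i)) (fun f => φ (w f)) l := by
    intro l
    simp only [derivSol, map_neg, map_sum, map_mul, map_derivCoeff]
  have ha : ∀ i, φ (valueSol hk x μ w i) =
      valueSol hk (fun l => φ (x l)) (fun i => φ (μ i)) (fun f => φ (w f)) i := by
    intro i
    simp only [valueSol, map_neg, map_sum, map_mul, map_add, map_valueCoeff, apply_ite φ, hb,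
      map_zero]
  simp only [singularCoeff, Function.comp_apply]
  rcases (splitIndex j hk).symm t with (i | l) | f
  · exact ha i
  · exact hb l
  · rfl

end Parametrization

/-- Used to move x and μ into a chart: a normalizes x, and b independently normalizes μ. -/
theorem IsSing.smul_smul {K ι : Type*} [Field K] [Fintype ι] {N : ℕ}
    {F : ι → MvPolynomial (Fin (N + 1)) K} {d : ι → ℕ} (hF : ∀ i, (F i).IsHomogeneous (d i))
    {x : Fin (N + 1) → K} {μ : ι → K} (h : IsSing F x μ) {a : K} (ha : a ≠ 0) (b : K) :
    IsSing F (a⁻¹ • x) fun i => b * (μ i * a ^ (d i - 1)) := by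
  refine ⟨fun i => by rw [(hF i).eval_smul, h.1 i, mul_zero], fun l => ?_⟩
  rw [← mul_zero b, ← h.2 l, Finset.mul_sum]
  refine Finset.sum_congr rfl fun i _ => ?_
  rw [(hF i).pderiv.eval_smul]
  have : a ^ (d i - 1) * a⁻¹ ^ (d i - 1) = 1 := by
    rw [← mul_pow, mul_inv_cancel₀ ha, one_pow]
  linear_combination b * μ i * eval x (pderiv l (F i)) * this

theorem MvPolynomial.eval_bind₁ {K σ τ : Type*} [CommRing K] (p : σ → K)
    (q : τ → MvPolynomial σ K) (g : MvPolynomial τ K) :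
    eval p (bind₁ q g) = eval (fun t => eval p (q t)) g :=
  eval₂Hom_bind₁ _ _ _ _

/-! ### Affine charts of the incidence variety. -/

section Parametrization

variable {N : ℕ} {ι : Type*} {d : ι → ℕ} {K : Type*} [Field K] {j : Fin (N + 1)} {k : ι}
  (hk : 1 ≤ d k)

/-- The parameters of the tuples of forms with a marked singular point `x`, `x j = 1`, and a marked
relation `μ`, `μ k = 1`. -/
abbrev ParamIndex (j : Fin (N + 1)) {k : ι} (hk : 1 ≤ d k) : Type _ :=
  ({l : Fin (N + 1) // l ≠ j} ⊕ {i : ι // i ≠ k}) ⊕ FreeIndex j hk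

/-- With c forms, the c + N bound coefficients are replaced by N coordinates of x and c - 1
coordinates of μ: one parameter fewer. -/
theorem card_paramIndex_lt [Fintype ι] [DecidableEq ι] :
    Fintype.card (ParamIndex j hk) < Fintype.card (CoeffIndex N d) := by
  rw [← Fintype.card_congr (splitIndex j hk)]
  simp only [Fintype.card_sum]
  have : Fintype.card {i : ι // i ≠ k} < Fintype.card ι :=
    Fintype.card_subtype_lt (x := k) (by simp)
  omega

variable (K)

/-- The coordinates of the marked singular point. -/
def markedPoint (l : Fin (N + 1)) : MvPolynomial (ParamIndex j hk) K :=
  if h : l = j then 1 else X (Sum.inl (Sum.inl ⟨l, h⟩))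

variable {K} in
theorem markedPoint_ne_zero (l : Fin (N + 1)) : markedPoint K (j := j) hk l ≠ 0 := by
  unfold markedPoint
  split_ifs
  exacts [one_ne_zero, X_ne_zero _]

variable {K} in
theorem eval_markedPoint_self (p : ParamIndex j hk → K) : eval p (markedPoint K hk j) = 1 := by
  simp [markedPoint]

variable [DecidableEq ι]

/-- The coordinates of the marked relation. -/
def markedRelation (i : ι) : MvPolynomial (ParamIndex j hk) K :=
  if h : i = k then 1 else X (Sum.inl (Sum.inr ⟨i, h⟩))

variable {K}

theorem markedRelation_ne_zero (i : ι) : markedRelation K (j := j) hk i ≠ 0 := by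
  unfold markedRelation
  split_ifs
  exacts [one_ne_zero, X_ne_zero _]

theorem eval_markedRelation_self (p : ParamIndex j hk → K) :
    eval p (markedRelation K hk k) = 1 := by
  simp [markedRelation]

variable [Fintype ι]

variable (K) in
/-- The coefficients of the generic tuple of forms with a marked singular point. -/
def genericCoeff (t : CoeffIndex N d) : MvPolynomial (ParamIndex j hk) K :=
  singularCoeff hk (markedPoint K hk) (markedRelation K hk) (fun f => X (Sum.inr f)) t

theorem eval_genericCoeff (p : ParamIndex j hk → K) (t : CoeffIndex N d) :
    eval p (genericCoeff K hk t) = singularCoeff hk (fun l => eval p (markedPoint K hk l))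
      (fun i => eval p (markedRelation K hk i)) (fun f => p (Sum.inr f)) t := by
  rw [genericCoeff, map_singularCoeff]
  simp only [eval_X]

/-- The missing equation for ∂_j comes from Euler's relation: since the forms vanish at x, ∑ x_l (∑
μ_i ∂_l F_i) = 0, and x_j = 1. -/
theorem eq_singularCoeff_iff_isSing {x : Fin (N + 1) → K} (hx : x j = 1) {μ : ι → K}
    (hμ : μ k = 1) (v : CoeffIndex N d → K) :
    v = singularCoeff (j := j) hk x μ (fun f => v f) ↔ IsSing (ofCoeff v) x μ := by
  rw [eq_singularCoeff_iff hk hx hμ, IsSing]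
  simp only [eval_ofCoeff, sum_mul_eval_pderiv_ofCoeff, implies_true, true_and]
  refine and_congr_right fun h0 => ⟨fun h l => ?_, fun h l _ => h l⟩
  by_cases hl : l = j
  · subst hl
    rw [← sum_mul_eval_pderiv_ofCoeff]
    have heuler : ∑ l, x l * ∑ i, μ i * eval x (pderiv l (ofCoeff v i)) = 0 := by
      simp only [Finset.mul_sum]
      rw [Finset.sum_comm]
      refine Finset.sum_eq_zero fun i _ => ?_
      rw [← mul_zero (μ i), ← (isHomogeneous_ofCoeff v i).sum_mul_eval_pderiv
        ((eval_ofCoeff v x i).trans (h0 i)), Finset.mul_sum]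
      exact Finset.sum_congr rfl fun _ _ => by ring
    rw [Finset.sum_eq_single l (fun l' _ hl' => by
      rw [sum_mul_eval_pderiv_ofCoeff, h l' hl', mul_zero]) (by simp), hx, one_mul] at heuler
    exact heuler
  · exact h l hl

theorem isSing_eval_genericCoeff (p : ParamIndex j hk → K) :
    IsSing (ofCoeff fun t => eval p (genericCoeff K hk t)) (fun l => eval p (markedPoint K hk l))
      fun i => eval p (markedRelation K hk i) := by
  have hx := eval_markedPoint_self hk p
  have hμ := eval_markedRelation_self hk p
  have h : (fun t => eval p (genericCoeff K hk t)) = singularCoeff hk _ _ _ :=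
    funext (eval_genericCoeff hk p)
  rw [← eq_singularCoeff_iff_isSing hk hx hμ]
  conv_lhs => rw [h]
  congr 1
  funext f
  exact (((eq_singularCoeff_iff hk hx hμ _ _).1 h).1 f).symm

theorem hasSing_eval_genericCoeff (p : ParamIndex j hk → K) :
    HasSing (ofCoeff fun t => eval p (genericCoeff K hk t)) :=
  ⟨_, fun h => one_ne_zero ((eval_markedPoint_self hk p).symm.trans (congrFun h j)), _,
    fun h => one_ne_zero ((eval_markedRelation_self hk p).symm.trans (congrFun h k)),
    isSing_eval_genericCoeff hk p⟩

theorem IsSing.exists_param_of_eq_one {x : Fin (N + 1) → K} (hx : x j = 1) {μ : ι → K}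
    (hμ : μ k = 1) {v : CoeffIndex N d → K} (h : IsSing (ofCoeff v) x μ) :
    ∃ p : ParamIndex j hk → K, v = fun t => eval p (genericCoeff K hk t) := by
  refine ⟨Sum.elim (Sum.elim (fun l => x l) fun i => μ i) fun f => v f, ?_⟩
  funext t
  refine (congrFun ((eq_singularCoeff_iff_isSing hk hx hμ v).2 h) t).trans ?_
  rw [eval_genericCoeff]
  congr 1
  · funext l
    unfold markedPoint
    split_ifs with hl
    · rw [hl, hx, map_one]
    · simp
  · funext i
    unfold markedRelation
    split_ifs with hi
    · rw [hi, hμ, map_one]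
    · simp

theorem IsSing.exists_param {x : Fin (N + 1) → K} (hx : x j ≠ 0) {μ : ι → K}
    (hμ : μ k ≠ 0) {v : CoeffIndex N d → K} (h : IsSing (ofCoeff v) x μ) :
    ∃ p : ParamIndex j hk → K, v = fun t => eval p (genericCoeff K hk t) :=
  -- The second scalar makes the k-th entry of the rescaled relation equal to 1.
  (h.smul_smul (isHomogeneous_ofCoeff v) hx (μ k * x j ^ (d k - 1))⁻¹).exists_param_of_eq_one hk
    (by simp [hx]) (inv_mul_cancel₀ (mul_ne_zero hμ (pow_ne_zero _ hx)))

/-- The tuples with a singular point in a given chart and a relation involving a given form are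
dense in the discriminant. -/
theorem HasSing.eval_eq_zero [Infinite K] (hd : ∀ i, 1 ≤ d i) {g : MvPolynomial (CoeffIndex N d) K}
    (hg : bind₁ (genericCoeff K (j := j) hk) g = 0) {v : CoeffIndex N d → K}
    (hv : HasSing (ofCoeff v)) : eval v g = 0 := by
  obtain ⟨x, hx, μ, hμ, h⟩ := hv
  obtain ⟨j', hj'⟩ := Function.ne_iff.1 hx
  obtain ⟨k', hk'⟩ := Function.ne_iff.1 hμ
  obtain ⟨p, rfl⟩ := h.exists_param (hd k') hj' hk'
  -- Change of chart: where x_j and μ_k are nonzero, the tuple also comes from chart (j, k), so the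
  -- pullback of g vanishes there. Its product with x_j μ_k is therefore zero, and the polynomial
  -- ring is a domain.
  have hz : bind₁ (genericCoeff K (j := j') (hd k')) g = 0 := by
    have : bind₁ (genericCoeff K (j := j') (hd k')) g *
        (markedPoint K (hd k') j * markedRelation K (j := j') (hd k') k) = 0 := by
      refine MvPolynomial.funext fun p => ?_
      rw [map_zero, map_mul, map_mul]
      by_cases h1 : eval p (markedPoint K (hd k') j) = 0
      · rw [h1, zero_mul, mul_zero]
      by_cases h2 : eval p (markedRelation K (j := j') (hd k') k) = 0
      · rw [h2, mul_zero, mul_zero]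
      obtain ⟨p', hp'⟩ := (isSing_eval_genericCoeff (hd k') p).exists_param hk h1 h2
      have := congrArg (eval p') hg
      rw [map_zero, eval_bind₁] at this
      rw [eval_bind₁, hp', this, zero_mul]
    exact (mul_eq_zero.1 this).resolve_right
      (mul_ne_zero (markedPoint_ne_zero _ _) (markedRelation_ne_zero _ _))
  have := congrArg (eval p) hz
  rwa [map_zero, eval_bind₁] at this

/-- More coefficients than parameters, so the generic coefficients are algebraically dependent. -/
theorem exists_bind₁_genericCoeff_eq_zero :
    ∃ g : MvPolynomial (CoeffIndex N d) K, g ≠ 0 ∧ bind₁ (genericCoeff K (j := j) hk) g = 0 := by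
  have h : ¬ AlgebraicIndependent K (genericCoeff K (j := j) hk) := by
    intro h
    have := h.lift_cardinalMk_le_trdeg
    rw [MvPolynomial.trdeg_of_isDomain] at this
    simp only [Cardinal.mk_fintype, Cardinal.lift_natCast, Nat.cast_le] at this
    exact absurd (card_paramIndex_lt (j := j) hk) (not_lt.2 this)
  rw [algebraicIndependent_iff] at h
  push Not at h
  obtain ⟨g, hg, hg0⟩ := h
  exact ⟨g, hg0, hg⟩

end Parametrization

/-- All singular tuples lie on the hypersurface given by that dependence, which is not the whole
space. -/
theorem exists_not_hasSing {N : ℕ} {ι K : Type*} [Fintype ι] {d : ι → ℕ} [Field K]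
    [Infinite K] (hd : ∀ i, 1 ≤ d i) : ∃ v : CoeffIndex N d → K, ¬ HasSing (ofCoeff v) := by
  classical
  rcases isEmpty_or_nonempty ι with hι | ⟨⟨k⟩⟩
  -- With no forms there is no nonzero relation; this case serves the empty subfamily.
  · exact ⟨0, fun ⟨_, _, μ, hμ, _⟩ => hμ (Subsingleton.elim _ _)⟩
  obtain ⟨g, hg0, hg⟩ := exists_bind₁_genericCoeff_eq_zero (K := K) (j := (0 : Fin (N + 1))) (hd k)
  by_contra! h
  exact hg0 (MvPolynomial.funext fun v => by
    rw [(h v).eval_eq_zero (hd k) hd hg, map_zero])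

/-! ### Chevalley's theorem and existence of common zeros. -/

/-- The image of a nonempty principal open subset under a morphism of affine spaces contains a
nonempty open subset of the closure of the image. -/
theorem exists_forall_exists_eval_eq {K σ τ : Type*} [Field K] [IsAlgClosed K] [Finite σ] [Finite τ]
    (q : τ → MvPolynomial σ K) {h : MvPolynomial σ K} (hh : h ≠ 0) :
    ∃ f : MvPolynomial τ K, bind₁ q f ≠ 0 ∧
      ∀ v : τ → K, (∀ g, bind₁ q g = 0 → eval v g = 0) → eval v f ≠ 0 →
        ∃ p : σ → K, eval p h ≠ 0 ∧ v = fun t => eval p (q t) := by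
  let φ : MvPolynomial τ K →+* MvPolynomial σ K := (bind₁ q : _ →ₐ[K] _)
  have hφ : φ.FinitePresentation := by
    refine RingHom.FinitePresentation.of_comp_finiteType (C : K →+* MvPolynomial τ K) ?_ ?_
    · have : φ.comp C = algebraMap K (MvPolynomial σ K) := (bind₁ q).comp_algebraMap
      rw [this, RingHom.finitePresentation_algebraMap]
      infer_instance
    · exact RingHom.finiteType_algebraMap.2
        (inferInstance : Algebra.FiniteType K (MvPolynomial τ K))
  obtain ⟨S, hS⟩ := PrimeSpectrum.exists_constructibleSetData_iff.2
    (PrimeSpectrum.isConstructible_comap_image hφ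
      (PrimeSpectrum.isConstructible_basicOpen (f := h)))
  -- The image of the generic point lies in one locally closed piece of the image. The equations of
  -- that piece pull back to zero and its f does not, so the piece contains every point of the
  -- closure where f ≠ 0.
  have hη : PrimeSpectrum.comap φ ⟨⊥, Ideal.isPrime_bot⟩ ∈ S.toSet := by
    rw [hS]
    exact ⟨_, hh, rfl⟩
  simp only [PrimeSpectrum.ConstructibleSetData.toSet, Set.mem_iUnion] at hη
  obtain ⟨C, hC, hη⟩ := hη
  have hη1 : ∀ i, φ (C.g i) = 0 := fun i => hη.1 ⟨i, rfl⟩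
  have hη2 : φ C.f ≠ 0 := fun h0 => hη.2 (by rintro _ rfl; exact h0)
  refine ⟨C.f, hη2, fun v hv hf => ?_⟩
  have hm : (⟨RingHom.ker (eval v), RingHom.ker_isPrime _⟩ : PrimeSpectrum (MvPolynomial τ K)) ∈
      S.toSet := by
    simp only [PrimeSpectrum.ConstructibleSetData.toSet, Set.mem_iUnion]
    refine ⟨C, hC, ?_, fun h0 => hf (h0 rfl)⟩
    rintro _ ⟨i, rfl⟩
    exact hv _ (hη1 i)
  rw [hS] at hm
  obtain ⟨P, hP, hPv⟩ := hm
  -- The preimage of v is only a prime P; any K-point of its zero locus with h ≠ 0 also maps to v,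
  -- because each X t - v t pulls back into P.
  obtain ⟨y, hy, hyh⟩ := exists_mem_zeroLocus_of_isPrime P.asIdeal hP
  refine ⟨y, hyh, funext fun t => ?_⟩
  have ht : X t - MvPolynomial.C (v t) ∈ (PrimeSpectrum.comap φ P).asIdeal := by
    rw [hPv]
    simp [RingHom.mem_ker]
  have h1 := hy _ ht
  have h2 : φ (X t - MvPolynomial.C (v t)) = q t - MvPolynomial.C (v t) := by
    simp [φ]
  rw [h2, map_sub, eval_C, sub_eq_zero] at h1
  exact h1.symm

/-- The ideal of the first `k` coordinates. -/
def coordIdeal (K : Type*) [Field K] (n k : ℕ) : Ideal (MvPolynomial (Fin n) K) :=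
  RingHom.ker (bind₁ (fun i : Fin n => if i.1 < k then (0 : MvPolynomial (Fin n) K) else X i))

theorem coordIdeal_lt_succ (K : Type*) [Field K] {n k : ℕ} (hk : k < n) :
    coordIdeal K n k < coordIdeal K n (k + 1) := by
  refine lt_of_le_of_ne (fun f hf => ?_) fun h => ?_
  · have hf : bind₁ _ f = 0 := hf
    have := congrArg (bind₁ fun i : Fin n => if i.1 < k + 1 then (0 : MvPolynomial (Fin n) K)
      else X i) hf
    rw [bind₁_bind₁, map_zero] at this
    refine Eq.trans ?_ this
    refine congrArg (fun g => bind₁ g f) (funext fun i => ?_)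
    by_cases h1 : i.1 < k
    · simp [h1, h1.trans (Nat.lt_succ_self k)]
    · simp [h1]
  · have h1 : (X ⟨k, hk⟩ : MvPolynomial (Fin n) K) ∈ coordIdeal K n (k + 1) := by
      simp [coordIdeal, RingHom.mem_ker]
    rw [← h] at h1
    simp [coordIdeal, RingHom.mem_ker] at h1

/-- The coordinate ideals form a strictly increasing chain of primes. -/
theorem le_height_coordIdeal (K : Type*) [Field K] {n k : ℕ} (hk : k ≤ n) :
    (k : ℕ∞) ≤ (coordIdeal K n k).height := by
  have hp : ∀ k, (coordIdeal K n k).IsPrime := fun k => RingHom.ker_isPrime _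
  induction k with
  | zero => simp
  | succ k ih =>
    have := hp k
    have := hp (k + 1)
    rw [Nat.cast_succ]
    exact (add_le_add_left (ih (Nat.le_of_succ_le hk)) 1).trans
      (Ideal.height_add_one_le_of_lt_of_isPrime (coordIdeal_lt_succ K hk))

theorem coordIdeal_self (K : Type*) [Field K] (n : ℕ) :
    coordIdeal K n n = RingHom.ker (eval (0 : Fin n → K)) := by
  ext f
  have h : (fun i : Fin n => if i.1 < n then (0 : MvPolynomial (Fin n) K) else X i) = 0 := by
    funext i
    simp
  rw [coordIdeal, h, RingHom.mem_ker, RingHom.mem_ker, ← map_eq_zero_iff C (C_injective (Fin n) K)]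
  have : (bind₁ (0 : Fin n → MvPolynomial (Fin n) K)) f = C (eval 0 f) := by
    change aeval (0 : Fin n → MvPolynomial (Fin n) K) f = _
    rw [aeval_zero]
    simp [constantCoeff_eq, eval_zero]
  rw [this]

/-- At most `N` forms of positive degree have a common zero in projective space. -/
theorem exists_ne_zero_forall_eval_eq_zero {K ι : Type*} [Field K] [IsAlgClosed K] [Fintype ι]
    {N : ℕ} (hι : Fintype.card ι ≤ N) {d : ι → ℕ} (hd : ∀ i, 1 ≤ d i)
    {F : ι → MvPolynomial (Fin (N + 1)) K} (hF : ∀ i, (F i).IsHomogeneous (d i)) :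
    ∃ x ≠ 0, ∀ i, eval x (F i) = 0 := by
  by_contra! h
  have hz : ∀ i, eval 0 (F i) = 0 := fun i => by
    have := (hF i).eval_smul 0 0
    rwa [zero_smul, zero_pow (Nat.one_le_iff_ne_zero.1 (hd i)), zero_mul] at this
  -- If the origin is the only common zero, its ideal is minimal over the F_i, so Krull's height
  -- theorem bounds its height by N; but that height is at least N + 1.
  have hmin : RingHom.ker (eval (0 : Fin (N + 1) → K)) ∈
      (Ideal.span (Set.range F)).minimalPrimes := by
    refine ⟨⟨RingHom.ker_isPrime _, Ideal.span_le.2 (by rintro _ ⟨i, rfl⟩; exact hz i)⟩, ?_⟩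
    rintro P ⟨hP, hFP⟩ hle f hf
    by_contra hfP
    obtain ⟨y, hy, hyf⟩ := exists_mem_zeroLocus_of_isPrime P hfP
    refine hyf ?_
    have : y = 0 := by
      by_contra hy0
      obtain ⟨i, hi⟩ := h y hy0
      exact hi (hy _ (hFP (Ideal.subset_span ⟨i, rfl⟩)))
    rw [this]
    exact hf
  have h1 := Ideal.height_le_card_of_mem_minimalPrimes_span (Set.finite_range F) hmin
  rw [← coordIdeal_self] at h1
  have h2 := (le_height_coordIdeal K le_rfl).trans h1
  have h3 : (Set.range F).ncard ≤ Fintype.card ι := by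
    rw [← Set.image_univ, ← Nat.card_eq_fintype_card, ← Set.ncard_univ]
    exact Set.ncard_image_le
  have h4 : N + 1 ≤ (Set.range F).ncard := by exact_mod_cast h2
  omega

/-! ### Zariski topology of a parametrized set. -/

section Zariski

variable {K V σ τ : Type*} [Field K] [AddCommGroup V] [Module K V]

/-- Linear forms are linear combinations of the coordinates, so polynomials in the former become
polynomials in the latter by substitution. -/
theorem isClosed_zariskiTopology_iff_coord [Finite τ] (e : V ≃ₗ[K] (τ → K)) {Z : Set V} :
    IsClosed[zariskiTopology K V] Z ↔
      ∃ T : Set (MvPolynomial τ K), Z = {v | ∀ g ∈ T, eval (e v) g = 0} := by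
  classical
  have := Fintype.ofFinite τ
  rw [isClosed_zariskiTopology_iff]
  constructor
  · rintro ⟨T, rfl⟩
    let q : Module.Dual K V → MvPolynomial τ K := fun φ =>
      ∑ t, X t * C (φ (e.symm fun i => if t = i then 1 else 0))
    have hq : ∀ v φ, eval (e v) (q φ) = φ v := by
      intro v φ
      have := LinearMap.pi_apply_eq_sum_univ (φ ∘ₗ e.symm.toLinearMap) (e v)
      rw [LinearMap.comp_apply, LinearEquiv.coe_coe, LinearEquiv.symm_apply_apply] at this
      rw [this]
      simp [q]
    refine ⟨bind₁ q '' T, Set.ext fun v => ?_⟩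
    simp only [polyZeros, Set.mem_ofPred_eq, Set.forall_mem_image, eval_bind₁, hq]
  · rintro ⟨T, rfl⟩
    refine ⟨rename (fun t => (LinearMap.proj t ∘ₗ e.toLinearMap : Module.Dual K V)) '' T,
      Set.ext fun v => ?_⟩
    simp only [polyZeros, Set.mem_ofPred_eq, Set.forall_mem_image, eval_rename]
    rfl

variable [Infinite K] (e : V ≃ₗ[K] (τ → K)) {D : Set V} {q : τ → MvPolynomial σ K}

theorem exists_mem_eval_ne_zero (hq : ∀ p v, (e v = fun t => eval p (q t)) → v ∈ D)
    {g : MvPolynomial τ K} (hg : bind₁ q g ≠ 0) :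
    ∃ v ∈ D, eval (e v) g ≠ 0 := by
  by_contra! h
  refine hg (MvPolynomial.funext fun p => ?_)
  rw [map_zero, eval_bind₁, ← h _ (hq p (e.symm fun t => eval p (q t)) (e.apply_symm_apply _)),
    e.apply_symm_apply]

/-- D contains the image of q and satisfies every polynomial equation of that image. Hence a
polynomial vanishes on D iff its pullback is zero, and the pullbacks live in a domain. -/
theorem isIrreducible_of_param [Finite τ] (hq : ∀ p v, (e v = fun t => eval p (q t)) → v ∈ D)
    (hD : ∀ g, bind₁ q g = 0 → ∀ v ∈ D, eval (e v) g = 0) :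
    @IsIrreducible V (zariskiTopology K V) D := by
  let _ := zariskiTopology K V
  refine ⟨⟨_, hq 0 (e.symm _) (e.apply_symm_apply _)⟩, ?_⟩
  rw [isPreirreducible_iff_isClosed_union_isClosed]
  intro Z₁ Z₂ h₁ h₂ h
  obtain ⟨T₁, rfl⟩ := (isClosed_zariskiTopology_iff_coord e).1 h₁
  obtain ⟨T₂, rfl⟩ := (isClosed_zariskiTopology_iff_coord e).1 h₂
  by_contra! hc
  have key : ∀ T : Set (MvPolynomial τ K), ¬ D ⊆ {v | ∀ g ∈ T, eval (e v) g = 0} →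
      ∃ g ∈ T, bind₁ q g ≠ 0 := by
    intro T hT
    by_contra! h0
    exact hT fun v hv g hg => hD g (h0 g hg) v hv
  obtain ⟨g₁, hg₁, h₁⟩ := key _ hc.1
  obtain ⟨g₂, hg₂, h₂⟩ := key _ hc.2
  obtain ⟨v, hv, hv0⟩ := exists_mem_eval_ne_zero (g := g₁ * g₂) e hq
    (by rw [map_mul]; exact mul_ne_zero h₁ h₂)
  rw [map_mul] at hv0
  rcases h hv with h | h
  · exact hv0 (by rw [h _ hg₁, zero_mul])
  · exact hv0 (by rw [h _ hg₂, mul_zero])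

/-- If f vanishes on D where g ≠ 0, then g * f vanishes on D; its pullback is zero, hence so is that
of f. -/
theorem subset_closure_of_param [Finite τ] (hq : ∀ p v, (e v = fun t => eval p (q t)) → v ∈ D)
    (hD : ∀ g, bind₁ q g = 0 → ∀ v ∈ D, eval (e v) g = 0)
    {g : MvPolynomial τ K} (hg : bind₁ q g ≠ 0) :
    D ⊆ @closure V (zariskiTopology K V) (D ∩ {v | eval (e v) g ≠ 0}) := by
  let _ := zariskiTopology K V
  obtain ⟨T, hT⟩ := (isClosed_zariskiTopology_iff_coord e).1
    (isClosed_closure (s := D ∩ {v | eval (e v) g ≠ 0}))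
  have hsub := subset_closure (s := D ∩ {v | eval (e v) g ≠ 0})
  rw [hT] at hsub ⊢
  intro v hv f hf
  refine hD f ?_ v hv
  by_contra hf0
  obtain ⟨w, hw, hw0⟩ := exists_mem_eval_ne_zero (g := g * f) e hq
    (by rw [map_mul]; exact mul_ne_zero hg hf0)
  rw [map_mul] at hw0
  exact (mul_ne_zero_iff.1 hw0).2 (hsub ⟨hw, (mul_ne_zero_iff.1 hw0).1⟩ f hf)

end Zariski

/-! ### The discriminant locus. -/

section Discriminant

variable {K : Type*} [Field K] {N c : ℕ}

/-- The coordinates on the space of tuples of forms given by the coefficients. -/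
def coeffEquiv (K : Type*) [Field K] (N : ℕ) {c : ℕ} (d : Fin c → ℕ) :
    EqSpace K N d ≃ₗ[K] (CoeffIndex N d → K) where
  toFun F t := coeff t.2.1 (F t.1 : MvPolynomial (Fin (N + 1)) K)
  map_add' _ _ := by ext; simp
  map_smul' _ _ := by ext; simp
  invFun v i := ⟨ofCoeff v i, isHomogeneous_ofCoeff v i⟩
  left_inv F := by
    funext i
    exact Subtype.ext (congrFun (ofCoeff_coeff fun i => (F i).2) i)
  right_inv v := funext fun t => coeff_ofCoeff v t

variable {d : Fin c → ℕ}

theorem ofCoeff_coeffEquiv (F : EqSpace K N d) :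
    ofCoeff (coeffEquiv K N d F) = fun i => (F i : MvPolynomial (Fin (N + 1)) K) :=
  ofCoeff_coeff fun i => (F i).2

variable [IsAlgClosed K]

theorem mem_discriminantLocus_iff {F : EqSpace K N d} :
    F ∈ discriminantLocus K N d ↔ HasSing (ofCoeff (coeffEquiv K N d F)) := by
  have h := isSmoothOfCodim_iff (F := fun i => (F i : MvPolynomial (Fin (N + 1)) K))
    fun i => (F i).2
  rw [Fintype.card_fin] at h
  rw [ofCoeff_coeffEquiv, ← not_iff_not, ← h]
  exact not_not

/-- For F outside the discriminant, elimination gives a polynomial nonzero at F and vanishing on the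
discriminant. -/
theorem isClosed_discriminantLocus :
    IsClosed[zariskiTopology K (EqSpace K N d)] (discriminantLocus K N d) := by
  rw [isClosed_zariskiTopology_iff_coord (coeffEquiv K N d)]
  refine ⟨{g | ∀ F ∈ discriminantLocus K N d, eval (coeffEquiv K N d F) g = 0},
    Set.ext fun F => ⟨fun hF g hg => hg F hF, fun h => ?_⟩⟩
  rw [mem_discriminantLocus_iff]
  by_contra hF
  obtain ⟨f, hf, hs⟩ := exists_forall_not_hasSing _ hF
  refine hf (h f fun G hG => ?_)
  by_contra hG0
  exact hs _ hG0 (mem_discriminantLocus_iff.1 hG)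

/-- Generically on the discriminant, a proper subfamily of the forms is nonsingular. -/
theorem exists_forall_not_hasSing_of_ne_univ (hcN : c ≤ N + 1) (hd : ∀ i, 1 ≤ d i) {j : Fin (N + 1)}
    (k : Fin c) {I : Finset (Fin c)} (hI : I ≠ Finset.univ) :
    ∃ f : MvPolynomial (CoeffIndex N d) K, bind₁ (genericCoeff K (j := j) (hd k)) f ≠ 0 ∧
      ∀ v, eval v f ≠ 0 → ¬ HasSing fun i : I => ofCoeff v i := by
  obtain ⟨w, hw⟩ := exists_not_hasSing (K := K) (N := N) (d := fun i : I => d i) fun i => hd i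
  obtain ⟨f, hf, hs⟩ := exists_forall_not_hasSing w hw
  obtain ⟨l, hl⟩ : ∃ l, l ∉ I := by
    by_contra! h
    exact hI (Finset.eq_univ_iff_forall.2 h)
  have hcard : Fintype.card I ≤ N := by
    have := Finset.card_lt_univ_of_notMem hl
    rw [Fintype.card_fin] at this
    rw [Fintype.card_coe]
    omega
  obtain ⟨x, hx, hx0⟩ := exists_ne_zero_forall_eval_eq_zero hcard (fun i : I => hd i)
    (isHomogeneous_ofCoeff w)
  let r : CoeffIndex N (fun i : I => d i) → CoeffIndex N d := fun t => ⟨t.1, t.2⟩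
  -- Completing w by zero forms gives a point of the discriminant: x is a common zero, and the zero
  -- form of index l gives the relation e_l. The condition f does not vanish there, so its pullback
  -- is nonzero.
  let v : CoeffIndex N d → K := fun t => if h : t.1 ∈ I then w ⟨⟨t.1, h⟩, t.2⟩ else 0
  have hvr : v ∘ r = w := funext fun t => dif_pos t.1.2
  have hr : ∀ u : CoeffIndex N d → K, ofCoeff (u ∘ r) = fun i : I => ofCoeff u i :=
    fun u => funext fun i => rfl
  have hv : HasSing (ofCoeff v) := by
    have hnot : ∀ i ∉ I, ofCoeff v i = 0 := fun i hi =>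
      Finset.sum_eq_zero fun m _ => by simp [v, hi]
    refine ⟨x, hx, Pi.single l 1, by simp, fun i => ?_, fun m => ?_⟩
    · by_cases hi : i ∈ I
      · rw [← hx0 ⟨i, hi⟩, ← hvr, hr]
      · rw [hnot i hi, map_zero]
    · refine Finset.sum_eq_zero fun i _ => ?_
      by_cases hi : i = l
      · rw [hi, hnot l hl, map_zero, map_zero, mul_zero]
      · rw [Pi.single_eq_of_ne hi, zero_mul]
  refine ⟨rename r f, fun h => hf ?_, fun u hu => ?_⟩
  · rw [← hvr, ← eval_rename]
    exact hv.eval_eq_zero (hd k) hd h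
  · rw [eval_rename] at hu
    rw [← hr]
    exact hs _ hu

end Discriminant

end

/-! ### The main theorem. -/

theorem mainTheorem6 (K : Type*) [Field K] [IsAlgClosed K] (N c : ℕ) (hc : 1 ≤ c)
    (hcN : c ≤ N + 1) (d : Fin c → ℕ) (hd : ∀ i, 1 ≤ d i) :
    IsClosed[zariskiTopology K (EqSpace K N d)] (discriminantLocus K N d) ∧
    @IsIrreducible (EqSpace K N d) (zariskiTopology K (EqSpace K N d))
      (discriminantLocus K N d) ∧
    ∃ U : Set (EqSpace K N d),
      IsOpen[zariskiTopology K (EqSpace K N d)] U ∧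
      discriminantLocus K N d ⊆
        @closure (EqSpace K N d) (zariskiTopology K (EqSpace K N d))
          (discriminantLocus K N d ∩ U) ∧
      ∀ F ∈ discriminantLocus K N d ∩ U,
        (∃ x : Fin (N + 1) → K, (∀ j, x j ≠ 0) ∧
          IsSingularPoint (fun i => (F i : MvPolynomial (Fin (N + 1)) K)) c x) ∧
        ∀ I : Finset (Fin c), I ≠ Finset.univ →
          IsSmoothOfCodim (fun i : I => (F i : MvPolynomial (Fin (N + 1)) K)) I.card := by
  let k : Fin c := ⟨0, hc⟩
  let e := coeffEquiv K N d
  let q := genericCoeff K (N := N) (j := 0) (hd k)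
  have hq : ∀ p F, (e F = fun t => eval p (q t)) → F ∈ discriminantLocus K N d := by
    intro p F hF
    rw [mem_discriminantLocus_iff]
    change HasSing (ofCoeff (e F))
    rw [hF]
    exact hasSing_eval_genericCoeff (hd k) p
  have hD : ∀ g, bind₁ q g = 0 → ∀ F ∈ discriminantLocus K N d, eval (e F) g = 0 :=
    fun g hg F hF => (mem_discriminantLocus_iff.1 hF).eval_eq_zero (hd k) hd hg
  refine ⟨isClosed_discriminantLocus, isIrreducible_of_param e hq hD, ?_⟩
  -- The open set of parameters consists of those whose marked point has no zero coordinate.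
  obtain ⟨f₀, hf₀, h₀⟩ := exists_forall_exists_eval_eq q
    (h := ∏ l, markedPoint K (hd k) l)
    (Finset.prod_ne_zero_iff.2 fun l _ => markedPoint_ne_zero (hd k) l)
  choose f hf hs using fun I : {I : Finset (Fin c) // I ≠ Finset.univ} =>
    exists_forall_not_hasSing_of_ne_univ (K := K) (j := 0) hcN hd k I.2
  -- There are finitely many proper subsets I, so one product imposes all the open conditions; its
  -- pullback is nonzero because each factor's is.
  let g := f₀ * ∏ I, f I
  have hg : bind₁ q g ≠ 0 := by
    rw [map_mul, map_prod]
    exact mul_ne_zero hf₀ (Finset.prod_ne_zero_iff.2 fun I _ => hf I)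
  refine ⟨{F | eval (e F) g ≠ 0}, ?_, subset_closure_of_param e hq hD hg, ?_⟩
  · rw [← @isClosed_compl_iff _ (zariskiTopology K (EqSpace K N d)),
      isClosed_zariskiTopology_iff_coord e]
    exact ⟨{g}, by ext; simp⟩
  rintro F ⟨hF, hFg⟩
  have hFg : eval (e F) f₀ * ∏ I, eval (e F) (f I) ≠ 0 := by
    rw [← map_prod, ← map_mul]
    exact hFg
  obtain ⟨hF₀, hFf⟩ := mul_ne_zero_iff.1 hFg
  rw [Finset.prod_ne_zero_iff] at hFf
  constructor
  · obtain ⟨p, hp, hpF⟩ := h₀ (e F) (fun g hg => hD g hg F hF) hF₀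
    rw [map_prod, Finset.prod_ne_zero_iff] at hp
    refine ⟨fun l => eval p (markedPoint K (hd k) l), fun l => hp l (Finset.mem_univ l), ?_⟩
    have hsing := isSing_eval_genericCoeff (hd k) p
    change IsSing (ofCoeff fun t => eval p (q t)) _ _ at hsing
    rw [← hpF, ofCoeff_coeffEquiv] at hsing
    have := hsing.isSingularPoint (fun i => (F i).2)
      (fun h => one_ne_zero ((eval_markedRelation_self (hd k) p).symm.trans (congrFun h k)))
      (fun h => hp 0 (Finset.mem_univ 0) (congrFun h 0))
    rwa [Fintype.card_fin] at this
  · intro I hI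
    have h := isSmoothOfCodim_iff (F := fun i : I => (F i : MvPolynomial (Fin (N + 1)) K))
      fun i => (F i).2
    rw [Fintype.card_coe] at h
    rw [h]
    have := hs ⟨I, hI⟩ (e F) (hFf _ (Finset.mem_univ _))
    rwa [ofCoeff_coeffEquiv] at this
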